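/- **Setting.** Let $\mathcal X$ be a measurable space (for example a Borel subset of $\mathbb R^d$), $\mathcal Y\subset\mathbb R^m$, and let $k:\mathcal X\times\mathcal X\to\mathbb R$ be a jointly measurable (symmetric, positive semidefinite) kernel with $k(x,x')\le\kappa$ for all $x,x'$. Let $M\in\mathbb R^{m\times m}$ be symmetric positive semidefinite and invertible, and let $\mathcal H$ be the reproducing kernel Hilbert space of $\mathbb R^m$-valued functions on $\mathcal X$ with the decomposable kernel $K(x,x')=k(x,x')M$; write $\mathbb B_1=\{f\in\mathcal H:\|f\|_{\mathcal H}\le1\}$ (the hypothesis set). Let $P$ be a probability distribution on $\mathcal X\times\mathbb R^m$ with $Y\in\mathcal Y$ almost surely for $(X,Y)\sim P$, let $(x_i,y_i)_{i=1}^n$, $n\ge1$, be i.i.d. from $P$, and write $\mathcal R(f)=\mathbb E_{(X,Y)\sim P}[\ell(f(X),Y)]$. The loss $\ell:\mathbb R^m\times\mathbb R^m\to\mathbb R$ is measurable, $z\mapsto\ell(z,y)$ is $J_\ell$-Lipschitz for every $y\in\mathcal Y$, and the loss is normalized so that it oscillates by at most $1$ over the hypothesis set: $|\ell(f(x),y)-\ell(g(x),y)|\le1$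 for all $f,g\in\mathbb B_1$, $x\in\mathcal X$, $y\in\mathcal Y$ (this holds for instance if $\ell(f(x),y)\in[0,1]$ for all such $f,x,y$, or if $2J_\ell\sqrt{\kappa\|M\|}\le1$). The risk is attained: there is $f_{\mathcal H}\in\mathbb B_1$ with $\ell(f_{\mathcal H}(X),Y)$ integrable and $\mathcal R(f_{\mathcal H})\le\mathcal R(f)$ for all $f\in\mathbb B_1$. **Spectral quantities.** Let $\mathbf k_0=(k(x_i,x_j))_{i,j}$ and let $\mathbf k_0/n=UDU^\top$ with $U$ orthogonal, $D=\operatorname{diag}(\mu_1,\dots,\mu_n)$, $\mu_1\ge\dots\ge\mu_n$. Let $$\delta_n^2=\inf\Big\{t>0:\Big(\tfrac1n\sum_{i=1}^n\min(t,\mu_i)\Big)^{1/2}\le t\Big\},$$ and let $d_n$ be the least $j\in\{1,\dots,n\}$ with $\mu_j\le\delta_n^2$, or $d_n=n$ if there is none. Let $U_1\in\mathbb R^{n\times d_n}$ and $U_2\in\mathbb R^{n\times(n-d_n)}$ be the left and right blocks of $U$ and $D_2=\operatorname{diag}(\mu_{d_n+1},\dots,\mu_n)$. For $c>0$, a matrix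 $S\in\mathbb R^{s\times n}$ is $\mathbf k_0$-satisfiable with constant $c$ if, in spectral norm, $\|(SU_1)^\top SU_1-I_{d_n}\|\le\frac12$ and $\|SU_2D_2^{1/2}\|\le c\,\delta_n$. **Sketched estimator.** Let $S\in\mathbb R^{s\times n}$ be a sketch, possibly random and depending on the sample, that is almost surely $\mathbf k_0$-satisfiable with constant $c>0$. Let $\lambda_n\ge0$. For $\Gamma\in\mathbb R^{s\times m}$ put $f_\Gamma=\sum_{j=1}^n k(\cdot,x_j)M[S^\top\Gamma]_{j:}$. Let $\tilde f_s=f_{\tilde\Gamma}$, where $\tilde\Gamma$ almost surely minimizes $$\frac1n\sum_{i=1}^n\ell\big([\mathbf k_0S^\top\Gamma M]_{i:},y_i\big)+\frac{\lambda_n}2\operatorname{Tr}\big(S\mathbf k_0S^\top\Gamma M\Gamma^\top\big)$$ over all $\Gamma\in\mathbb R^{s\times m}$ with $f_\Gamma\in\mathbb B_1$. **Claim.** For every $\delta\in(0,1)$, with probability at least $1-\delta$, $$\mathcal R(\tilde f_s)\le\mathcal R(f_{\mathcal H})+J_\ell(1+\sqrt6\,c)\sqrt{\lambda_n+\|M\|\,\delta_n^2}+\frac{\lambda_n}2+8J_\ell\sqrt{\frac{\kappa\operatorname{Tr}(M)}n}+2\sqrt{\frac{8\log(4/\delta)}n},$$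 where $\|M\|$ is the spectral norm. (Precisely: there is an event of probability at least $1-\delta$ on which the inequality holds.) -/

import Mathlib

open MeasureTheory ProbabilityTheory
open scoped Matrix NNReal Matrix.Norms.L2Operator

/-- A scalar kernel: a symmetric function all of whose Gram matrices are positive semidefinite. -/
structure IsScalarKernel {X : Type*} (k : X → X → ℝ) : Prop where
  symm : ∀ x x', k x x' = k x' x
  nonneg : ∀ (n : ℕ) (x : Fin n → X) (α : Fin n → ℝ),
    0 ≤ ∑ i, ∑ j, α i * k (x i) (x j) * α j

/-- The reproducing kernel of the `ℝᵐ`-valued RKHS `H` is `K(x, x') = k(x, x') M`. -/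
def HasDecomposableKernel {X : Type*} {m : ℕ} (H : Type*) [NormedAddCommGroup H]
    [InnerProductSpace ℝ H] [CompleteSpace H] [RKHS ℝ H X (EuclideanSpace ℝ (Fin m))]
    (k : X → X → ℝ) (M : Matrix (Fin m) (Fin m) ℝ) : Prop :=
  ∀ x x', RKHS.kernel H x x' = k x x' • Matrix.toEuclideanCLM (𝕜 := ℝ) M

/-- The scalar Gram matrix `(k(xᵢ, xⱼ))ᵢⱼ`. -/
def gramMatrix {X : Type*} {n : ℕ} (k : X → X → ℝ) (x : Fin n → X) : Matrix (Fin n) (Fin n) ℝ :=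
  Matrix.of fun i j => k (x i) (x j)

/-- `A = U diag(μ) Uᵀ` with `U` orthogonal and `μ` in decreasing order. -/
structure IsEigendecomposition {n : ℕ} (A U : Matrix (Fin n) (Fin n) ℝ) (μ : Fin n → ℝ) :
    Prop where
  orthogonal : U ∈ Matrix.orthogonalGroup (Fin n) ℝ
  antitone : Antitone μ
  eq : A = U * Matrix.diagonal μ * Uᵀ

/-- The squared critical radius `δ²`: the infimum of the positive `t` (playing the role of `δ²`)
with `((1/n) ∑ᵢ min(t, μᵢ))^{1/2} ≤ t`. (The value `t = 0` satisfies the inequality trivially and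
is not a candidate.) -/
noncomputable def criticalRadiusSq {n : ℕ} (μ : Fin n → ℝ) : ℝ :=
  sInf {t : ℝ | 0 < t ∧ √((1 / (n : ℝ)) * ∑ i, min t (μ i)) ≤ t}

open Classical in
/-- The statistical dimension: the least one-based index `j` with `μⱼ ≤ δ²`, and `n` if there is
none. The zero-based index `j : Fin n` is the one-based index `j + 1`. -/
noncomputable def statDim {n : ℕ} (μ : Fin n → ℝ) : ℕ :=
  if ∃ j, μ j ≤ criticalRadiusSq μ then
    sInf {d : ℕ | ∃ j : Fin n, d = (j : ℕ) + 1 ∧ μ j ≤ criticalRadiusSq μ}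
  else n

/-- The left block: the first `d` columns. -/
def leftBlock {n : ℕ} (U : Matrix (Fin n) (Fin n) ℝ) (d : ℕ) :
    Matrix (Fin n) {j : Fin n // (j : ℕ) < d} ℝ :=
  U.submatrix id Subtype.val

/-- The right block: the remaining columns. -/
def rightBlock {n : ℕ} (U : Matrix (Fin n) (Fin n) ℝ) (d : ℕ) :
    Matrix (Fin n) {j : Fin n // d ≤ (j : ℕ)} ℝ :=
  U.submatrix id Subtype.val

/-- Satisfiability of a sketch `S` with constant `c`, for a normalized Gram matrix with
eigendecomposition `U diag(μ) Uᵀ`. Norms are spectral norms. -/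
def IsSatisfiable {s n : ℕ} (U : Matrix (Fin n) (Fin n) ℝ) (μ : Fin n → ℝ)
    (S : Matrix (Fin s) (Fin n) ℝ) (c : ℝ) : Prop :=
  ‖(S * leftBlock U (statDim μ))ᵀ * (S * leftBlock U (statDim μ)) - 1‖ ≤ 1 / 2 ∧
  ‖S * rightBlock U (statDim μ) *
      Matrix.diagonal (fun j : {j : Fin n // statDim μ ≤ (j : ℕ)} => √(μ j))‖
    ≤ c * √(criticalRadiusSq μ)

/-- The expected risk `E[ℓ(f(X), Y)]` for `(X, Y)` of law `P`. -/
noncomputable def risk {X E : Type*} [MeasurableSpace X] [MeasurableSpace E]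
    (P : Measure (X × E)) (ℓ : E → E → ℝ) (f : X → E) : ℝ :=
  ∫ p, ℓ (f p.1) p.2 ∂P

/-- The function `∑ⱼ K(·, xⱼ) [Sᵀ Γ]ⱼ:` of `H`. -/
noncomputable def sketchedFunction {X : Type*} {m n s : ℕ} (H : Type*) [NormedAddCommGroup H]
    [InnerProductSpace ℝ H] [CompleteSpace H] [RKHS ℝ H X (EuclideanSpace ℝ (Fin m))]
    (x : Fin n → X) (S : Matrix (Fin s) (Fin n) ℝ) (Γ : Matrix (Fin s) (Fin m) ℝ) : H :=
  ∑ j, RKHS.kerFun H (x j) (WithLp.toLp 2 ((Sᵀ * Γ).row j))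

/-- The sketched objective
`(1/n) ∑ᵢ ℓ([G Sᵀ Γ M]ᵢ:, yᵢ) + (lam/2) Tr(S G Sᵀ Γ M Γᵀ)`, with `G` the scalar Gram matrix. -/
noncomputable def sketchedObjective {m n s : ℕ}
    (ℓ : EuclideanSpace ℝ (Fin m) → EuclideanSpace ℝ (Fin m) → ℝ)
    (G : Matrix (Fin n) (Fin n) ℝ) (M : Matrix (Fin m) (Fin m) ℝ)
    (y : Fin n → EuclideanSpace ℝ (Fin m)) (lam : ℝ)
    (S : Matrix (Fin s) (Fin n) ℝ) (Γ : Matrix (Fin s) (Fin m) ℝ) : ℝ :=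
  (1 / (n : ℝ)) * ∑ i, ℓ (WithLp.toLp 2 ((G * Sᵀ * Γ * M).row i)) (y i) +
    lam / 2 * (S * G * Sᵀ * Γ * M * Γᵀ).trace

/-- `Γ` minimizes the sketched objective over the parameters whose function lies in the hypothesis
set, the closed unit ball of `H`. -/
def IsSketchedSolution {X : Type*} {m n s : ℕ} (H : Type*) [NormedAddCommGroup H]
    [InnerProductSpace ℝ H] [CompleteSpace H] [RKHS ℝ H X (EuclideanSpace ℝ (Fin m))]
    (k : X → X → ℝ) (M : Matrix (Fin m) (Fin m) ℝ)
    (ℓ : EuclideanSpace ℝ (Fin m) → EuclideanSpace ℝ (Fin m) → ℝ) (lam : ℝ)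
    (x : Fin n → X) (y : Fin n → EuclideanSpace ℝ (Fin m))
    (S : Matrix (Fin s) (Fin n) ℝ) (Γ : Matrix (Fin s) (Fin m) ℝ) : Prop :=
  ‖sketchedFunction H x S Γ‖ ≤ 1 ∧
  ∀ Γ' : Matrix (Fin s) (Fin m) ℝ, ‖sketchedFunction H x S Γ'‖ ≤ 1 →
    sketchedObjective ℓ (gramMatrix k x) M y lam S Γ ≤
      sketchedObjective ℓ (gramMatrix k x) M y lam S Γ'

/-! Everything is run on the excess loss `ℓ (f x) y - ℓ (fH x) y`, bounded by 1 over the unit ball.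
A one-sided deviation inequality, uniform over the ball, applies to the sample-dependent estimator
and reduces the claim to the empirical excess loss. Centring at `fH` removes the need for a separate
concentration bound for `fH`.

Empirical part. The competitor is the orthogonal projection of `fH` onto the space of sketched
functions; it stays in the ball. Orthogonality of the residual to that space says that the sketch
annihilates its values on the sample. In the eigenbasis, the high-frequency values of the residual
are small because the eigenvalues there are at most `δ²`, and satisfiability transfers this
smallness to the low frequencies (`sum_sq_le_of_isSatisfiable`, `exists_sketchedFunction_approx`).
Minimality and the Lipschitz property conclude (`sum_loss_sketchedSolution_le`).

Deviation part. For finitely many functions, the sample coordinates are replaced one at a time by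
Rademacher sums in the Hilbert space. Each replacement combines symmetrization with a vector
contraction resting on Khintchine's inequality (`integral_iSup_le_integral_signAvg`); second moments
then give the mean bound `4JB√n`, with `B² = κ Tr M` (`integral_iSup_empirical_le`). Bounded
differences control the fluctuation, and continuity from below passes to countable families.

The space `H` may be nonseparable, so a countable dense set need not exist. There is, however, a
closed separable subspace `K` such that every function orthogonal to it vanishes almost everywhere
(`exists_separable_submodule`). Almost surely, the components off `K` of the kernel functions at
distinct sample points are orthogonal, so the part of any `f` off `K` has values on the sample
summing to at most `B√n` in norm. This turns the constant 4 into 5 (`exists_event_integral_le`). -/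

/-- The average over all sign vectors `ε : Fin m → {±1}`. -/
noncomputable def signAvg {m : ℕ} (g : (Fin m → ℤˣ) → ℝ) : ℝ := (2 ^ m : ℝ)⁻¹ * ∑ ε, g ε

/-! ### Rademacher averages and a Khintchine inequality -/

section SignAvg

variable {m : ℕ}

lemma signAvg_mono {g h : (Fin m → ℤˣ) → ℝ} (H : ∀ ε, g ε ≤ h ε) : signAvg g ≤ signAvg h :=
  mul_le_mul_of_nonneg_left (Finset.sum_le_sum fun ε _ => H ε) (by positivity)

lemma signAvg_add (g h : (Fin m → ℤˣ) → ℝ) :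
    signAvg (fun ε => g ε + h ε) = signAvg g + signAvg h := by
  simp [signAvg, Finset.sum_add_distrib, mul_add]

lemma signAvg_const_mul (c : ℝ) (g : (Fin m → ℤˣ) → ℝ) :
    signAvg (fun ε => c * g ε) = c * signAvg g := by
  simp only [signAvg, ← Finset.mul_sum]; ring

lemma signAvg_const (c : ℝ) : signAvg (fun _ : Fin m → ℤˣ => c) = c := by
  simp [signAvg]

lemma signAvg_neg (g : (Fin m → ℤˣ) → ℝ) : signAvg (fun ε => g (-ε)) = signAvg g := by
  unfold signAvg
  congr 1
  exact Fintype.sum_equiv (Equiv.neg _) _ _ fun _ => rfl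

lemma signAvg_succ (g : (Fin (m + 1) → ℤˣ) → ℝ) :
    signAvg g = signAvg fun ε => (g (Fin.cons 1 ε) + g (Fin.cons (-1) ε)) / 2 := by
  unfold signAvg
  have : ∑ ε, g ε = ∑ p : ℤˣ × (Fin m → ℤˣ), g (Fin.cons p.1 p.2) :=
    (Fintype.sum_equiv (Fin.consEquiv fun _ => ℤˣ) _ _ fun _ => rfl).symm
  rw [this, Fintype.sum_prod_type, Finset.sum_comm, ← Finset.sum_div, pow_succ]
  have h2 : ∀ f : ℤˣ → ℝ, ∑ e, f e = f 1 + f (-1) := by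
    intro f
    rw [show (Finset.univ : Finset ℤˣ) = {1, -1} from rfl, Finset.sum_pair (by decide)]
  simp only [h2]
  field_simp

lemma sq_signAvg_le (g : (Fin m → ℤˣ) → ℝ) : signAvg g ^ 2 ≤ signAvg fun ε => g ε ^ 2 := by
  have h : 0 ≤ signAvg fun ε => (g ε - signAvg g) ^ 2 := by
    unfold signAvg; positivity
  have h' : (fun ε => (g ε - signAvg g) ^ 2) =
      fun ε => g ε ^ 2 + ((-2 * signAvg g) * g ε + signAvg g ^ 2) := by
    funext ε; ring
  rw [h', signAvg_add, signAvg_add, signAvg_const_mul, signAvg_const] at h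
  nlinarith

lemma signAvg_sqrt_le (g : (Fin m → ℤˣ) → ℝ) (hg : ∀ ε, 0 ≤ g ε) :
    signAvg (fun ε => √(g ε)) ≤ √(signAvg g) := by
  refine Real.le_sqrt_of_sq_le ((sq_signAvg_le _).trans_eq ?_)
  simp only [Real.sq_sqrt (hg _)]

/-- Second moments of a Rademacher sum with values in an inner product space, with an offset. -/
lemma signAvg_norm_add_sum_sq {E : Type*} [NormedAddCommGroup E] [InnerProductSpace ℝ E] :
    ∀ {m : ℕ} (u : E) (v : Fin m → E),
      signAvg (fun ε : Fin m → ℤˣ => ‖u + ∑ a, ((ε a : ℤ) : ℝ) • v a‖ ^ 2) =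
        ‖u‖ ^ 2 + ∑ a, ‖v a‖ ^ 2
  | 0, u, v => by simp [signAvg]
  | m + 1, u, v => by
    rw [signAvg_succ, Fin.sum_univ_succ, add_comm (‖v 0‖ ^ 2), ← add_assoc,
      ← signAvg_norm_add_sum_sq u fun a => v a.succ, ← signAvg_const (m := m) (‖v 0‖ ^ 2),
      ← signAvg_add]
    congr 1
    funext ε
    simp only [Fin.sum_univ_succ, Fin.cons_zero, Fin.cons_succ, Units.val_one, Int.cast_one,
      Units.val_neg, Int.cast_neg, one_smul, neg_smul]
    set w := ∑ a : Fin m, ((ε a : ℤ) : ℝ) • v a.succ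
    have h := parallelogram_law_with_norm ℝ (u + w) (v 0)
    rw [show u + (v 0 + w) = u + w + v 0 by abel, show u + (-v 0 + w) = u + w - v 0 by abel]
    nlinarith

lemma signAvg_sum_sq (v : Fin m → ℝ) :
    signAvg (fun ε : Fin m → ℤˣ => (∑ a, ((ε a : ℤ) : ℝ) * v a) ^ 2) = ∑ a, v a ^ 2 := by
  simpa using signAvg_norm_add_sum_sq (0 : ℝ) v

/-- Averaging over one sign cancels the odd powers; the remaining terms `6 v₀² s + v₀⁴`, with `s`
the second moment of the rest, fit into the growth of `3 (s + v₀²)²`. -/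
lemma signAvg_sum_pow_four_le :
    ∀ {m : ℕ} (v : Fin m → ℝ),
      signAvg (fun ε : Fin m → ℤˣ => (∑ a, ((ε a : ℤ) : ℝ) * v a) ^ 4) ≤ 3 * (∑ a, v a ^ 2) ^ 2
  | 0, v => by simp [signAvg]
  | m + 1, v => by
    rw [signAvg_succ]
    have h : (fun ε : Fin m → ℤˣ =>
        ((∑ a, (((Fin.cons 1 ε : Fin (m + 1) → ℤˣ) a : ℤ) : ℝ) * v a) ^ 4 +
          (∑ a, (((Fin.cons (-1) ε : Fin (m + 1) → ℤˣ) a : ℤ) : ℝ) * v a) ^ 4) / 2) =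
        fun ε => (∑ a, ((ε a : ℤ) : ℝ) * v a.succ) ^ 4 +
          ((6 * v 0 ^ 2) * (∑ a, ((ε a : ℤ) : ℝ) * v a.succ) ^ 2 + v 0 ^ 4) := by
      funext ε
      simp only [Fin.sum_univ_succ, Fin.cons_zero, Fin.cons_succ, Units.val_one, Int.cast_one,
        Units.val_neg, Int.cast_neg]
      ring
    rw [h, signAvg_add, signAvg_add, signAvg_const_mul, signAvg_const, signAvg_sum_sq,
      Fin.sum_univ_succ]
    have := signAvg_sum_pow_four_le fun a => v a.succ
    nlinarith [sq_nonneg (v 0 ^ 2)]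

/-- A Khintchine inequality for the first absolute moment. -/
lemma norm_le_two_mul_signAvg (v : EuclideanSpace ℝ (Fin m)) :
    ‖v‖ ≤ 2 * signAvg fun ε => |∑ a, ((ε a : ℤ) : ℝ) * v a| := by
  rcases eq_or_ne v 0 with rfl | hv
  · simp [signAvg]
  set N := ‖v‖
  have hN : 0 < N := norm_pos_iff.2 hv
  have hN2 : ∑ a, v a ^ 2 = N ^ 2 := by
    rw [EuclideanSpace.norm_sq_eq]; simp
  -- With `t = |x| / N` this is `t (t - 2)² (t + 4) ≥ 0`. Averaging the quartic minorant, with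
  -- second moment `N²` and fourth moment at most `3 N⁴`, gives `(3/4 - 3/16) N = 9N/16 ≥ N/2`.
  have key : ∀ x : ℝ, (3 / 4 * N⁻¹) * x ^ 2 + (-(1 / 16) * N⁻¹ ^ 3) * x ^ 4 ≤ |x| := by
    intro x
    have h1 : 0 ≤ |x| * ((|x| * N⁻¹ - 2) ^ 2 * (|x| * N⁻¹ + 4)) / 16 := by positivity
    have h2 : x ^ 4 = |x| ^ 4 := by rw [pow_abs, abs_of_nonneg (by positivity)]
    rw [h2, ← sq_abs x]
    linarith [h1]
  have h := signAvg_mono fun ε : Fin m → ℤˣ => key (∑ a, ((ε a : ℤ) : ℝ) * v a)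
  rw [signAvg_add, signAvg_const_mul, signAvg_const_mul, signAvg_sum_sq, hN2] at h
  have h4 := signAvg_sum_pow_four_le (m := m) v
  rw [hN2] at h4
  have h5 : N⁻¹ ^ 3 * signAvg (fun ε : Fin m → ℤˣ => (∑ a, ((ε a : ℤ) : ℝ) * v a) ^ 4) ≤ 3 * N := by
    calc _ ≤ N⁻¹ ^ 3 * (3 * (N ^ 2) ^ 2) := by gcongr
      _ = 3 * N := by field_simp
  have h6 : N⁻¹ * N ^ 2 = N := by field_simp
  linarith

end SignAvg

/-! ### Finite suprema and boundedness -/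

section FiniteSup

variable {ι : Type*} [Finite ι]

lemma le_iSup_of_finite (f : ι → ℝ) (i : ι) : f i ≤ ⨆ i, f i :=
  le_ciSup (Set.finite_range f).bddAbove i

lemma exists_forall_abs_le (f : ι → ℝ) : ∃ C, ∀ i, |f i| ≤ C := by
  obtain ⟨C, hC⟩ := (Set.finite_range fun i => |f i|).bddAbove
  exact ⟨C, fun i => hC ⟨i, rfl⟩⟩

variable [Nonempty ι]

lemma abs_iSup_le_of_finite {f : ι → ℝ} {C : ℝ} (h : ∀ i, |f i| ≤ C) : |⨆ i, f i| ≤ C := by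
  obtain ⟨i⟩ := ‹Nonempty ι›
  exact abs_le.2 ⟨(abs_le.1 (h i)).1.trans (le_iSup_of_finite f i),
    ciSup_le fun i => (abs_le.1 (h i)).2⟩

lemma abs_iSup_sub_iSup_le {f g : ι → ℝ} {C : ℝ} (h : ∀ i, |f i - g i| ≤ C) :
    |(⨆ i, f i) - ⨆ i, g i| ≤ C := by
  refine abs_sub_le_iff.2 ⟨?_, ?_⟩
  · refine sub_le_iff_le_add.2 (ciSup_le fun i => ?_)
    linarith [(abs_le.1 (h i)).2, le_iSup_of_finite g i]
  · refine sub_le_iff_le_add.2 (ciSup_le fun i => ?_)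
    linarith [(abs_le.1 (h i)).1, le_iSup_of_finite f i]

end FiniteSup

lemma integrable_of_abs_le {Z : Type*} [MeasurableSpace Z] {P : Measure Z} [IsFiniteMeasure P]
    {f : Z → ℝ} (hf : Measurable f) {C : ℝ} (hC : ∀ z, |f z| ≤ C) : Integrable f P :=
  .of_bound hf.aestronglyMeasurable C (.of_forall fun z => hC z)

lemma abs_integral_le_of_abs_le {Z : Type*} [MeasurableSpace Z] {P : Measure Z}
    [IsProbabilityMeasure P] {f : Z → ℝ} {C : ℝ} (hC : ∀ z, |f z| ≤ C) : |∫ z, f z ∂P| ≤ C := by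
  simpa using norm_integral_le_of_norm_le_const (μ := P) (f := f) (C := C) (.of_forall fun z => hC z)

lemma abs_signAvg_le {m : ℕ} {g : (Fin m → ℤˣ) → ℝ} {C : ℝ} (h : ∀ ε, |g ε| ≤ C) :
    |signAvg g| ≤ C := by
  refine abs_le.2 ⟨?_, ?_⟩
  · rw [← signAvg_const (m := m) (-C)]
    exact signAvg_mono fun ε => (abs_le.1 (h ε)).1
  · rw [← signAvg_const (m := m) C]
    exact signAvg_mono fun ε => (abs_le.1 (h ε)).2

lemma abs_sum_sign_mul_le {m : ℕ} (ε : Fin m → ℤˣ) (v : EuclideanSpace ℝ (Fin m)) :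
    |∑ a, ((ε a : ℤ) : ℝ) * v a| ≤ m * ‖v‖ := by
  calc |∑ a, ((ε a : ℤ) : ℝ) * v a| ≤ ∑ a, |((ε a : ℤ) : ℝ) * v a| :=
        Finset.abs_sum_le_sum_abs _ _
    _ ≤ ∑ _a : Fin m, ‖v‖ := Finset.sum_le_sum fun a _ => by
        have : |((ε a : ℤ) : ℝ)| = 1 := by
          rcases Int.units_eq_one_or (ε a) with h | h <;> simp [h]
        rw [abs_mul, this, one_mul]
        exact PiLp.norm_apply_le v a
    _ = m * ‖v‖ := by simp

lemma signAvg_iSup_measurable {Z ι : Type*} [MeasurableSpace Z] [Finite ι] {m : ℕ}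
    {f : (Fin m → ℤˣ) → ι → Z → ℝ} (hf : ∀ ε i, Measurable (f ε i)) :
    Measurable fun z => signAvg fun ε => ⨆ i, f ε i z := by
  unfold signAvg
  exact (Finset.measurable_sum _ fun ε _ => Measurable.iSup fun i => hf ε i).const_mul _

/-! ### Symmetrization and vector contraction in one coordinate -/

section Symmetrization

variable {Z ι : Type*} [MeasurableSpace Z] {P : Measure Z} [IsProbabilityMeasure P]
  [Finite ι] {m : ℕ} {h : ι → Z → ℝ} {φ : ι → Z → EuclideanSpace ℝ (Fin m)}
  {J : ℝ}

/-- Vector contraction at a single point. -/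
lemma add_add_norm_le_signAvg_iSup (hJ : 0 ≤ J) (A : ι → ℝ) (v : ι → EuclideanSpace ℝ (Fin m))
    (i j : ι) :
    A i + A j + 2 * J * ‖v i - v j‖ ≤
      2 * signAvg fun ε => ⨆ i, (A i + 4 * J * ∑ a, ((ε a : ℤ) : ℝ) * v i a) := by
  set s : (Fin m → ℤˣ) → ℝ := fun ε => ⨆ i, (A i + 4 * J * ∑ a, ((ε a : ℤ) : ℝ) * v i a)
  -- Evaluate one supremum at `i` and the other at `j`, assigning `ε` and `-ε` according to the sign
  -- of the difference; this produces the absolute value that Khintchine's inequality needs.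
  have hpt : ∀ ε : Fin m → ℤˣ,
      A i + A j + 4 * J * |∑ a, ((ε a : ℤ) : ℝ) * (v i - v j) a| ≤ s ε + s (-ε) := by
    intro ε
    have hs : ∀ (ε : Fin m → ℤˣ) i, A i + 4 * J * ∑ a, ((ε a : ℤ) : ℝ) * v i a ≤ s ε :=
      fun ε i => le_iSup_of_finite (fun i => A i + 4 * J * ∑ a, ((ε a : ℤ) : ℝ) * v i a) i
    have hneg : ∀ i, ∑ a, (((-ε) a : ℤ) : ℝ) * v i a = -∑ a, ((ε a : ℤ) : ℝ) * v i a := by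
      intro i; simp
    have h1 := hs ε i
    have h2 := hs ε j
    have h3 := hs (-ε) i
    have h4 := hs (-ε) j
    rw [hneg] at h3 h4
    have hd : ∑ a, ((ε a : ℤ) : ℝ) * (v i - v j) a =
        ∑ a, ((ε a : ℤ) : ℝ) * v i a - ∑ a, ((ε a : ℤ) : ℝ) * v j a := by
      simp [mul_sub]
    rw [hd]
    rcases abs_cases (∑ a, ((ε a : ℤ) : ℝ) * v i a - ∑ a, ((ε a : ℤ) : ℝ) * v j a) with
      ⟨h, -⟩ | ⟨h, -⟩ <;> rw [h] <;> nlinarith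
  have h1 := signAvg_mono hpt
  rw [signAvg_add, signAvg_const, signAvg_const_mul, signAvg_add, signAvg_neg] at h1
  have h2 := mul_le_mul_of_nonneg_left (norm_le_two_mul_signAvg (v i - v j)) hJ
  linarith

/-- One step of symmetrization followed by vector contraction: a centered coordinate of a finite
empirical process is replaced by a Rademacher sum. -/
lemma integral_iSup_le_integral_signAvg [Nonempty ι] (hm : ∀ i, Measurable (h i))
    (hb : ∀ i z, |h i z| ≤ 1)
    (hφ : ∀ i, Measurable (φ i)) {C : ℝ} (hC : ∀ i z, ‖φ i z‖ ≤ C) (hJ : 0 ≤ J)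
    (hlip : ∀ i j z, |h i z - h j z| ≤ J * ‖φ i z - φ j z‖) (A : ι → ℝ) :
    ∫ z, ⨆ i, (A i + (∫ w, h i w ∂P - h i z)) ∂P ≤
      ∫ z, signAvg (fun ε => ⨆ i, (A i + 4 * J * ∑ a, ((ε a : ℤ) : ℝ) * φ i z a)) ∂P := by
  obtain ⟨CA, hCA⟩ := exists_forall_abs_le A
  set T : Z → ℝ := fun z => signAvg fun ε => ⨆ i, (A i + 4 * J * ∑ a, ((ε a : ℤ) : ℝ) * φ i z a)
  have hT : Integrable T P := by
    refine integrable_of_abs_le (signAvg_iSup_measurable fun ε i => ?_)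
      (C := CA + 4 * J * (m * C)) fun z => abs_signAvg_le fun ε => abs_iSup_le_of_finite fun i => ?_
    · have : ∀ a, Measurable fun z => φ i z a := fun a => by have := hφ i; fun_prop
      fun_prop
    · refine (abs_add_le _ _).trans (add_le_add (hCA i) ?_)
      rw [abs_mul, abs_of_nonneg (by positivity : 0 ≤ 4 * J)]
      refine mul_le_mul_of_nonneg_left ((abs_sum_sign_mul_le ε _).trans ?_) (by positivity)
      exact mul_le_mul_of_nonneg_left (hC i z) (by positivity)
  have hint : ∀ i, Integrable (h i) P := fun i => integrable_of_abs_le (hm i) (hb i)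
  -- The mean of `h i` is replaced by an independent copy, and the supremum is pulled outside its
  -- expectation.
  set s : Z × Z → ℝ := fun p => ⨆ i, (A i + (h i p.2 - h i p.1))
  have hs_meas : Measurable s := Measurable.iSup fun i => by have := hm i; fun_prop
  have hs_bd : ∀ p, |s p| ≤ CA + 2 := fun p => abs_iSup_le_of_finite fun i => by
    refine (abs_add_le _ _).trans (add_le_add (hCA i) ((abs_sub _ _).trans ?_))
    linarith [hb i p.1, hb i p.2]
  have hs_int : Integrable s (P.prod P) := integrable_of_abs_le hs_meas hs_bd
  have hs_int' : Integrable (fun p => s p.swap) (P.prod P) := hs_int.swap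
  have hfubini : ∫ z, ⨆ i, (A i + (∫ w, h i w ∂P - h i z)) ∂P ≤ ∫ p, s p ∂(P.prod P) := by
    rw [integral_prod _ hs_int]
    refine integral_mono ?_ hs_int.integral_prod_left fun z => ciSup_le fun i => ?_
    · refine integrable_of_abs_le (C := CA + 2) (Measurable.iSup fun i => ?_) fun z =>
        abs_iSup_le_of_finite fun i => (abs_add_le _ _).trans (add_le_add (hCA i)
          ((abs_sub _ _).trans ?_))
      · have := hm i; fun_prop
      · linarith [hb i z, abs_integral_le_of_abs_le (P := P) (hb i)]
    · have : A i + (∫ w, h i w ∂P - h i z) = ∫ w, (A i + (h i w - h i z)) ∂P := by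
        rw [integral_add (f := fun _ => A i) (g := fun w => h i w - h i z) (integrable_const _)
          ((hint i).sub (integrable_const _)), integral_sub (hint i) (integrable_const _)]
        simp
      rw [this]
      refine integral_mono ((integrable_const _).add ((hint i).sub (integrable_const _)))
        (integrable_of_abs_le (hs_meas.comp measurable_prodMk_left) fun w => hs_bd (z, w))
        fun w => le_iSup_of_finite (fun i => A i + (h i w - h i z)) i
  -- With maximizers `i` and `j` for the two orders of the pair, the increments regroup as `h i - h
  -- j` at each point separately. The contraction at each of the two points is used with weight one
  -- half.
  have hsum : ∀ p : Z × Z, s p + s p.swap ≤ T p.1 + T p.2 := by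
    rintro ⟨z, z'⟩
    obtain ⟨i, hi⟩ := exists_eq_ciSup_of_finite (f := fun i => A i + (h i z' - h i z))
    obtain ⟨j, hj⟩ := exists_eq_ciSup_of_finite (f := fun i => A i + (h i z - h i z'))
    have e1 : s (z, z') = A i + (h i z' - h i z) := hi.symm
    have e2 : s (z', z) = A j + (h j z - h j z') := hj.symm
    rw [Prod.swap_prod_mk, e1, e2]
    have h1 := add_add_norm_le_signAvg_iSup hJ A (fun i => φ i z) i j
    have h2 := add_add_norm_le_signAvg_iSup hJ A (fun i => φ i z') i j
    have h3 := (abs_le.1 (hlip i j z)).1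
    have h4 := (abs_le.1 (hlip i j z')).2
    simp only [T]
    linarith
  have hsymm : ∫ p, (s p + s p.swap) ∂(P.prod P) ≤ ∫ p, (T p.1 + T p.2) ∂(P.prod P) :=
    integral_mono (hs_int.add hs_int') ((hT.comp_fst P).add (hT.comp_snd P)) hsum
  rw [integral_add hs_int hs_int', integral_prod_swap, integral_add (hT.comp_fst P)
    (hT.comp_snd P), integral_fun_fst, integral_fun_snd] at hsymm
  simp at hsymm
  linarith

end Symmetrization

/-! ### Expected suprema and exponential moments on product spaces -/

section Product

variable {Z : Type*} [MeasurableSpace Z] {P : Measure Z} [IsProbabilityMeasure P]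

lemma integral_pi_succ {n : ℕ} (F : (Fin (n + 1) → Z) → ℝ) :
    ∫ z, F z ∂(Measure.pi fun _ : Fin (n + 1) => P) =
      ∫ p : Z × (Fin n → Z), F (Fin.cons p.1 p.2) ∂(P.prod (Measure.pi fun _ : Fin n => P)) := by
  have h := (measurePreserving_piFinSuccAbove (fun _ : Fin (n + 1) => P) 0).integral_comp'
    fun p => F (Fin.cons p.1 p.2)
  rw [← h]
  congr 1
  funext z
  congr 1
  exact (Fin.cons_self_tail z).symm

lemma measurable_fin_cons {n : ℕ} :
    Measurable fun p : Z × (Fin n → Z) => (Fin.cons p.1 p.2 : Fin (n + 1) → Z) := by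
  refine measurable_pi_iff.2 fun k => ?_
  refine Fin.cases ?_ (fun k => ?_) k
  · simpa using measurable_fst
  · simp only [Fin.cons_succ]
    fun_prop

open scoped RealInnerProductSpace in
/-- Rademacher bound for the expected supremum of a finite empirical process indexed by elements of
the unit ball of a Hilbert space. -/
lemma integral_iSup_empirical_le {ι H : Type*} [Finite ι] [Nonempty ι] [NormedAddCommGroup H]
    [InnerProductSpace ℝ H] {m : ℕ} {h : ι → Z → ℝ} {f : ι → H} {e : Z → Fin m → H} {J B : ℝ}
    (hm : ∀ i, Measurable (h i)) (hb : ∀ i z, |h i z| ≤ 1) (hf : ∀ i, ‖f i‖ ≤ 1)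
    (hfe : ∀ i a, Measurable fun z => ⟪f i, e z a⟫) (hB : 0 ≤ B)
    (he : ∀ z, ∑ a, ‖e z a‖ ^ 2 ≤ B ^ 2) (hJ : 0 ≤ J)
    (hlip : ∀ i j z, |h i z - h j z| ≤ J * √(∑ a, ⟪f i - f j, e z a⟫ ^ 2)) :
    ∀ (n : ℕ) (u : H),
      ∫ z, ⨆ i, (⟪f i, u⟫ + ∑ k, (∫ w, h i w ∂P - h i (z k))) ∂(Measure.pi fun _ : Fin n => P) ≤
        √(‖u‖ ^ 2 + n * (16 * J ^ 2 * B ^ 2))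
  | 0, u => by
    simp only [Finset.univ_eq_empty, Finset.sum_empty, add_zero, integral_const, probReal_univ,
      one_smul, Nat.cast_zero, zero_mul]
    rw [Real.sqrt_sq (norm_nonneg _)]
    exact ciSup_le fun i => (real_inner_le_norm _ _).trans
      (mul_le_of_le_one_left (norm_nonneg _) (hf i))
  | n + 1, u => by
    set ν := Measure.pi fun _ : Fin n => P
    set φ : ι → Z → EuclideanSpace ℝ (Fin m) := fun i z => WithLp.toLp 2 fun a => ⟪f i, e z a⟫
    have hφ : ∀ i, Measurable (φ i) := fun i =>
      (MeasurableEquiv.toLp 2 (Fin m → ℝ)).measurable.comp (measurable_pi_iff.2 fun a => hfe i a)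
    have hφB : ∀ i z, ‖φ i z‖ ≤ B := by
      intro i z
      rw [EuclideanSpace.norm_eq]
      refine Real.sqrt_le_iff.2 ⟨hB, (Finset.sum_le_sum fun a _ => ?_).trans (he z)⟩
      simp only [φ, Real.norm_eq_abs]
      gcongr
      exact (abs_real_inner_le_norm _ _).trans (mul_le_of_le_one_left (norm_nonneg _) (hf i))
    have hlip' : ∀ i j z, |h i z - h j z| ≤ J * ‖φ i z - φ j z‖ := by
      intro i j z
      refine (hlip i j z).trans_eq ?_
      rw [EuclideanSpace.norm_eq]
      simp [φ, inner_sub_left]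
    set A : (Fin n → Z) → ι → ℝ := fun r i => ⟪f i, u⟫ + ∑ k, (∫ w, h i w ∂P - h i (r k))
    have hA : ∀ i, Measurable fun r => A r i := fun i => by
      have := hm i
      fun_prop
    have hmean : ∀ i, |∫ w, h i w ∂P| ≤ 1 := fun i => abs_integral_le_of_abs_le (hb i)
    have hAb : ∀ (v : H) (r : Fin n → Z) i,
        |⟪f i, v⟫ + ∑ k, (∫ w, h i w ∂P - h i (r k))| ≤ ‖v‖ + n * 2 := by
      intro v r i
      refine (abs_add_le _ _).trans (add_le_add ?_ ?_)
      · exact (abs_real_inner_le_norm _ _).trans (mul_le_of_le_one_left (norm_nonneg _) (hf i))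
      · refine (Finset.abs_sum_le_sum_abs _ _).trans ((Finset.sum_le_sum fun k _ =>
          (abs_sub _ _).trans (add_le_add (hmean i) (hb i _))).trans_eq ?_)
        simp only [Finset.sum_const, Finset.card_univ, Fintype.card_fin, nsmul_eq_mul]
        norm_num
    -- The Rademacher term is linear in `f i`, so it is absorbed into the offset. The induction
    -- closes because the offset `u` is arbitrary.
    set W : Z → (Fin m → ℤˣ) → H := fun z ε => u + ∑ a, ((ε a : ℤ) : ℝ) • ((4 * J) • e z a)
    have hW : ∀ z ε i r, A r i + 4 * J * ∑ a, ((ε a : ℤ) : ℝ) * φ i z a =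
        ⟪f i, W z ε⟫ + ∑ k, (∫ w, h i w ∂P - h i (r k)) := by
      intro z ε i r
      simp only [A, W, φ, inner_add_right, inner_sum, inner_smul_right, Finset.mul_sum]
      rw [add_right_comm]
      congr 2
      exact Finset.sum_congr rfl fun a _ => by ring
    set G : (Fin m → ℤˣ) → Z × (Fin n → Z) → ℝ := fun ε p =>
      ⨆ i, (A p.2 i + 4 * J * ∑ a, ((ε a : ℤ) : ℝ) * φ i p.1 a)
    have hGm : ∀ ε, Measurable (G ε) := fun ε => Measurable.iSup fun i => by
      have h1 : ∀ a, Measurable fun z => φ i z a := fun a => hfe i a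
      have h2 := hA i
      fun_prop
    have hGb : ∀ ε p, |G ε p| ≤ (‖u‖ + n * 2) + 4 * J * (m * B) := fun ε p =>
      abs_iSup_le_of_finite fun i => by
        refine (abs_add_le _ _).trans (add_le_add (hAb u p.2 i) ?_)
        rw [abs_mul, abs_of_nonneg (by positivity : 0 ≤ 4 * J)]
        refine mul_le_mul_of_nonneg_left ((abs_sum_sign_mul_le ε _).trans ?_) (by positivity)
        exact mul_le_mul_of_nonneg_left (hφB i p.1) (by positivity)
    have hGi : Integrable (fun p => signAvg fun ε => G ε p) (P.prod ν) :=
      integrable_of_abs_le ((Finset.measurable_sum _ fun ε _ => hGm ε).const_mul _)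
        fun p => abs_signAvg_le fun ε => hGb ε p
    set F : Z × (Fin n → Z) → ℝ := fun p => ⨆ i, (A p.2 i + (∫ w, h i w ∂P - h i p.1))
    have hFi : Integrable F (P.prod ν) := by
      refine integrable_of_abs_le (C := (‖u‖ + n * 2) + 2) (Measurable.iSup fun i => ?_) fun p =>
        abs_iSup_le_of_finite fun i => (abs_add_le _ _).trans (add_le_add (hAb u p.2 i)
          ((abs_sub _ _).trans ?_))
      · have h1 := hm i
        have h2 := hA i
        fun_prop
      · linarith [hb i p.1, hmean i]
    calc ∫ z, ⨆ i, (⟪f i, u⟫ + ∑ k, (∫ w, h i w ∂P - h i (z k)))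
          ∂(Measure.pi fun _ : Fin (n + 1) => P)
        = ∫ p, F p ∂(P.prod ν) := by
          rw [integral_pi_succ]
          congr 1
          funext p
          simp only [F, A, Fin.sum_univ_succ, Fin.cons_zero, Fin.cons_succ]
          congr 1
          funext i
          ring
      _ = ∫ r, ∫ z, F (z, r) ∂P ∂ν := integral_prod_symm _ hFi
      _ ≤ ∫ r, ∫ z, signAvg (fun ε => G ε (z, r)) ∂P ∂ν :=
          integral_mono hFi.integral_prod_right hGi.integral_prod_right fun r =>
            integral_iSup_le_integral_signAvg hm hb hφ hφB hJ hlip' (A r)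
      _ = ∫ z, ∫ r, signAvg (fun ε => G ε (z, r)) ∂ν ∂P := by
          rw [← integral_prod_symm _ hGi, integral_prod _ hGi]
      _ ≤ ∫ _z, √(‖u‖ ^ 2 + (n + 1 : ℕ) * (16 * J ^ 2 * B ^ 2)) ∂P := by
          refine integral_mono hGi.integral_prod_left (integrable_const _) fun z => ?_
          have hGz : ∀ ε, Integrable (fun r => G ε (z, r)) ν := fun ε =>
            integrable_of_abs_le ((hGm ε).comp measurable_prodMk_left) fun r => hGb ε (z, r)
          calc ∫ r, signAvg (fun ε => G ε (z, r)) ∂ν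
              = signAvg fun ε => ∫ r, G ε (z, r) ∂ν := by
                simp only [signAvg]
                rw [integral_const_mul, integral_finsetSum _ fun ε _ => hGz ε]
            _ ≤ signAvg fun ε => √(‖W z ε‖ ^ 2 + n * (16 * J ^ 2 * B ^ 2)) :=
                signAvg_mono fun ε => by
                  simp only [G, hW]
                  exact integral_iSup_empirical_le hm hb hf hfe hB he hJ hlip n (W z ε)
            -- Jensen's inequality moves the average under the root, where cross terms vanish and
            -- the new coordinate contributes at most `16 J² B²`.
            _ ≤ √(signAvg fun ε => ‖W z ε‖ ^ 2 + n * (16 * J ^ 2 * B ^ 2)) :=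
                signAvg_sqrt_le _ fun ε => by positivity
            _ ≤ √(‖u‖ ^ 2 + (n + 1 : ℕ) * (16 * J ^ 2 * B ^ 2)) := by
                refine Real.sqrt_le_sqrt ?_
                rw [signAvg_add, signAvg_const, signAvg_norm_add_sum_sq]
                have : ∑ a, ‖(4 * J) • e z a‖ ^ 2 = 16 * J ^ 2 * ∑ a, ‖e z a‖ ^ 2 := by
                  rw [Finset.mul_sum]
                  refine Finset.sum_congr rfl fun a _ => ?_
                  rw [norm_smul, mul_pow, Real.norm_eq_abs, sq_abs]
                  ring
                rw [this]
                have := mul_le_mul_of_nonneg_left (he z) (by positivity : 0 ≤ 16 * J ^ 2)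
                push_cast
                linarith
      _ = √(‖u‖ ^ 2 + (n + 1 : ℕ) * (16 * J ^ 2 * B ^ 2)) := by simp

/-- Hoeffding's lemma for a function oscillating by at most `c`. -/
lemma integral_exp_mul_le_of_abs_sub_le {g : Z → ℝ} (hg : Measurable g) {c : ℝ}
    (hc : ∀ z w, |g z - g w| ≤ c) (t : ℝ) :
    ∫ z, Real.exp (t * g z) ∂P ≤ Real.exp (t * ∫ z, g z ∂P + c ^ 2 * t ^ 2 / 2) := by
  obtain ⟨z₀⟩ := nonempty_of_isProbabilityMeasure P
  have hc0 : 0 ≤ c := (abs_nonneg _).trans (hc z₀ z₀)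
  -- An interval centred at one value has width `2c`, not the optimal `c`, but needs no extrema; the
  -- variance proxy is therefore `c²`.
  have h := hasSubgaussianMGF_of_mem_Icc (μ := P) (a := g z₀ - c) (b := g z₀ + c)
    hg.aemeasurable (.of_forall fun z => by
      have := abs_le.1 (hc z z₀)
      constructor <;> linarith)
  have h1 := h.mgf_le t
  have h2 : (fun z => Real.exp (t * g z)) =
      fun z => Real.exp (t * ∫ z, g z ∂P) * Real.exp (t * (g z - ∫ z, g z ∂P)) := by
    funext z
    rw [← Real.exp_add]
    ring_nf
  rw [h2, integral_const_mul, Real.exp_add]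
  refine mul_le_mul_of_nonneg_left (h1.trans_eq ?_) (Real.exp_nonneg _)
  congr 2
  have : (((‖g z₀ + c - (g z₀ - c)‖₊ / 2) ^ 2 : ℝ≥0) : ℝ) = c ^ 2 := by
    push_cast
    rw [Real.norm_eq_abs, div_pow, sq_abs]
    ring
  rw [this]

/-- Exponential moments of a function with bounded differences. -/
lemma integral_exp_mul_le_of_bounded_differences {c C : ℝ} (t : ℝ) :
    ∀ {n : ℕ} {g : (Fin n → Z) → ℝ}, Measurable g → (∀ z, |g z| ≤ C) →
      (∀ z k w, |g (Function.update z k w) - g z| ≤ c) →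
      ∫ z, Real.exp (t * g z) ∂(Measure.pi fun _ : Fin n => P) ≤
        Real.exp (t * ∫ z, g z ∂(Measure.pi fun _ : Fin n => P) + n * (c ^ 2 * t ^ 2 / 2))
  | 0, g, hg, hC, hc => by
    have : g = fun _ => g Fin.elim0 := by
      funext z
      congr 1
      exact Subsingleton.elim _ _
    rw [this]
    simp
  | n + 1, g, hg, hC, hc => by
    set ν := Measure.pi fun _ : Fin n => P
    set g' : Z × (Fin n → Z) → ℝ := fun p => g (Fin.cons p.1 p.2)
    have hg' : Measurable g' := hg.comp measurable_fin_cons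
    have hgi : Integrable g' (P.prod ν) := integrable_of_abs_le hg' fun p => hC _
    have hexp : Integrable (fun p => Real.exp (t * g' p)) (P.prod ν) := by
      refine integrable_of_abs_le (C := Real.exp (|t| * C)) (by fun_prop) fun p => ?_
      rw [Real.abs_exp, Real.exp_le_exp]
      refine (le_abs_self _).trans ?_
      rw [abs_mul]
      exact mul_le_mul_of_nonneg_left (hC _) (abs_nonneg _)
    have hgz : ∀ z, Integrable (fun r => g' (z, r)) ν := fun z =>
      integrable_of_abs_le (hg'.comp measurable_prodMk_left) fun r => hC _
    -- Averaging out the other coordinates preserves the oscillation bound in the first one, so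
    -- Hoeffding's lemma applies to `g₀` and the induction hypothesis to each slice.
    set g₀ : Z → ℝ := fun z => ∫ r, g' (z, r) ∂ν
    have hg₀ : Measurable g₀ := (hg'.stronglyMeasurable.integral_prod_right').measurable
    have hg₀c : ∀ z w, |g₀ z - g₀ w| ≤ c := by
      intro z w
      rw [← integral_sub (hgz z) (hgz w)]
      refine abs_integral_le_of_abs_le fun r => ?_
      have := hc (Fin.cons w r) 0 z
      rwa [Fin.update_cons_zero] at this
    have hg₀C : ∀ z, |g₀ z| ≤ C := fun z => abs_integral_le_of_abs_le fun r => hC _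
    rw [integral_pi_succ, integral_pi_succ, integral_prod _ hexp, integral_prod _ hgi]
    have hstep : ∀ z, ∫ r, Real.exp (t * g' (z, r)) ∂ν ≤
        Real.exp (t * g₀ z) * Real.exp (n * (c ^ 2 * t ^ 2 / 2)) := by
      intro z
      rw [← Real.exp_add]
      refine integral_exp_mul_le_of_bounded_differences t (hg'.comp measurable_prodMk_left)
        (fun r => hC _) fun r k w => ?_
      have := hc (Fin.cons z r) k.succ w
      rwa [← Fin.cons_update] at this
    calc ∫ z, ∫ r, Real.exp (t * g' (z, r)) ∂ν ∂P
        ≤ ∫ z, Real.exp (t * g₀ z) * Real.exp (n * (c ^ 2 * t ^ 2 / 2)) ∂P := by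
          refine integral_mono hexp.integral_prod_left (Integrable.mul_const ?_ _) hstep
          refine integrable_of_abs_le (C := Real.exp (|t| * C)) (by fun_prop) fun p => ?_
          rw [Real.abs_exp, Real.exp_le_exp]
          refine (le_abs_self _).trans ?_
          rw [abs_mul]
          exact mul_le_mul_of_nonneg_left (hg₀C _) (abs_nonneg _)
      _ ≤ Real.exp (t * ∫ z, g₀ z ∂P + c ^ 2 * t ^ 2 / 2) *
            Real.exp (n * (c ^ 2 * t ^ 2 / 2)) := by
          rw [integral_mul_const]
          exact mul_le_mul_of_nonneg_right (integral_exp_mul_le_of_abs_sub_le hg₀ hg₀c t)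
            (Real.exp_nonneg _)
      _ = _ := by
          rw [← Real.exp_add]
          congr 1
          push_cast
          ring

end Product

/-! ### Uniform deviation for finite and countable families -/

section Deviation

open scoped RealInnerProductSpace

variable {Z : Type*} [MeasurableSpace Z] {P : Measure Z} [IsProbabilityMeasure P]
  {ι H : Type*} [NormedAddCommGroup H] [InnerProductSpace ℝ H] {m : ℕ} {h : ι → Z → ℝ}
  {f : ι → H} {e : Z → Fin m → H} {J B : ℝ}

/-- Chernoff's method around the mean bound from `integral_iSup_empirical_le` with zero offset.
Finiteness makes the supremum measurable and attained. -/
lemma measureReal_exists_empirical_gt_le_of_finite [Finite ι] [Nonempty ι]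
    (hm : ∀ i, Measurable (h i)) (hb : ∀ i z, |h i z| ≤ 1) (hf : ∀ i, ‖f i‖ ≤ 1)
    (hfe : ∀ i a, Measurable fun z => ⟪f i, e z a⟫) (hB : 0 ≤ B)
    (he : ∀ z, ∑ a, ‖e z a‖ ^ 2 ≤ B ^ 2) (hJ : 0 ≤ J)
    (hlip : ∀ i j z, |h i z - h j z| ≤ J * √(∑ a, ⟪f i - f j, e z a⟫ ^ 2))
    {n : ℕ} (hn : 0 < n) {δ : ℝ} (hδ : 0 < δ) (hδ' : δ ≤ 1) :
    (Measure.pi fun _ : Fin n => P).real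
      {z | ∃ i, 4 * J * B * √n + √(8 * Real.log (1 / δ) * n) <
        ∑ k, (∫ w, h i w ∂P - h i (z k))} ≤ δ := by
  set ν := Measure.pi fun _ : Fin n => P
  set g : (Fin n → Z) → ℝ := fun z => ⨆ i, ∑ k, (∫ w, h i w ∂P - h i (z k))
  have hn' : (0 : ℝ) < n := by exact_mod_cast hn
  have hgm : Measurable g := Measurable.iSup fun i => by
    have := hm i
    fun_prop
  have hgC : ∀ z, |g z| ≤ n * 2 := fun z => abs_iSup_le_of_finite fun i => by
    refine (Finset.abs_sum_le_sum_abs _ _).trans ((Finset.sum_le_sum fun k _ =>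
      (abs_sub _ _).trans (add_le_add (abs_integral_le_of_abs_le (P := P) (hb i)) (hb i _))).trans_eq ?_)
    simp only [Finset.sum_const, Finset.card_univ, Fintype.card_fin, nsmul_eq_mul]
    norm_num
  have hgc : ∀ z k w, |g (Function.update z k w) - g z| ≤ 2 := by
    intro z k w
    refine abs_iSup_sub_iSup_le fun i => ?_
    rw [← Finset.sum_sub_distrib, Finset.sum_eq_single k]
    · rw [Function.update_self, sub_sub_sub_cancel_left]
      refine (abs_sub _ _).trans ?_
      linarith [hb i (z k), hb i w]
    · intro l _ hl
      simp [Function.update_of_ne hl]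
    · simp
  have hmean : ∫ z, g z ∂ν ≤ 4 * J * B * √n := by
    have h0 := integral_iSup_empirical_le (P := P) hm hb hf hfe hB he hJ hlip n 0
    simp only [inner_zero_right, zero_add, norm_zero] at h0
    refine h0.trans_eq ?_
    rw [show (0 : ℝ) ^ 2 + n * (16 * J ^ 2 * B ^ 2) = (4 * J * B) ^ 2 * n by ring,
      Real.sqrt_mul (by positivity), Real.sqrt_sq (by positivity)]
  have hlog : 0 ≤ Real.log (1 / δ) := Real.log_nonneg (by rw [le_div_iff₀ hδ]; linarith)
  set s := √(8 * Real.log (1 / δ) * n)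
  have hs2 : s ^ 2 = 8 * Real.log (1 / δ) * n := Real.sq_sqrt (by positivity)
  have hs0 : 0 ≤ s := Real.sqrt_nonneg _
  have hsub : {z | ∃ i, 4 * J * B * √n + s < ∑ k, (∫ w, h i w ∂P - h i (z k))} ⊆
      {z | ∫ z, g z ∂ν + s ≤ g z} := by
    rintro z ⟨i, hi⟩
    have := le_iSup_of_finite (fun i => ∑ k, (∫ w, h i w ∂P - h i (z k))) i
    simp only [Set.mem_ofPred_eq]
    linarith
  refine (measureReal_mono hsub).trans ?_
  -- The minimizer of `-t s + 2 n t²`, with minimum `-s² / (8 n) = log δ`.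
  set t := s / (4 * n)
  have ht : 0 ≤ t := by positivity
  have hexp : Integrable (fun z => Real.exp (t * g z)) ν := by
    refine integrable_of_abs_le (C := Real.exp (t * (n * 2))) (by fun_prop) fun p => ?_
    rw [Real.abs_exp, Real.exp_le_exp]
    exact mul_le_mul_of_nonneg_left (abs_le.1 (hgC p)).2 ht
  refine (measure_ge_le_exp_mul_mgf _ ht hexp).trans ?_
  have h1 := integral_exp_mul_le_of_bounded_differences (P := P) t hgm hgC hgc
  refine (mul_le_mul_of_nonneg_left h1 (Real.exp_nonneg _)).trans ?_
  rw [← Real.exp_add]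
  have h2 : -t * (∫ z, g z ∂ν + s) + (t * ∫ z, g z ∂ν + n * (2 ^ 2 * t ^ 2 / 2)) = Real.log δ := by
    have h3 : -t * s + n * (2 ^ 2 * t ^ 2 / 2) = - (s ^ 2 / (8 * n)) := by
      simp only [t]
      field_simp
      ring
    have h4 : s ^ 2 / (8 * n) = - Real.log δ := by
      rw [hs2, one_div, Real.log_inv]
      field_simp
    linarith
  rw [h2, Real.exp_log hδ]

/-- Uniform one-sided deviation bound for a countable class of functions. -/
lemma measureReal_exists_empirical_gt_le [Countable ι]
    (hm : ∀ i, Measurable (h i)) (hb : ∀ i z, |h i z| ≤ 1) (hf : ∀ i, ‖f i‖ ≤ 1)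
    (hfe : ∀ i a, Measurable fun z => ⟪f i, e z a⟫) (hB : 0 ≤ B)
    (he : ∀ z, ∑ a, ‖e z a‖ ^ 2 ≤ B ^ 2) (hJ : 0 ≤ J)
    (hlip : ∀ i j z, |h i z - h j z| ≤ J * √(∑ a, ⟪f i - f j, e z a⟫ ^ 2))
    {n : ℕ} (hn : 0 < n) {δ : ℝ} (hδ : 0 < δ) (hδ' : δ ≤ 1) :
    (Measure.pi fun _ : Fin n => P).real
      {z | ∃ i, 4 * J * B * √n + √(8 * Real.log (1 / δ) * n) <
        ∑ k, (∫ w, h i w ∂P - h i (z k))} ≤ δ := by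
  classical
  set r := 4 * J * B * √n + √(8 * Real.log (1 / δ) * n)
  set E : Finset ι → Set (Fin n → Z) := fun s =>
    {z | ∃ i : s, r < ∑ k, (∫ w, h i w ∂P - h i (z k))}
  have hE : {z : Fin n → Z | ∃ i, r < ∑ k, (∫ w, h i w ∂P - h i (z k))} = ⋃ s, E s := by
    ext z
    simp only [Set.mem_ofPred_eq, Set.mem_iUnion, E]
    constructor
    · rintro ⟨i, hi⟩
      exact ⟨{i}, ⟨i, Finset.mem_singleton_self i⟩, hi⟩
    · rintro ⟨s, i, hi⟩
      exact ⟨i, hi⟩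
  have hdir : Directed (· ⊆ ·) E := by
    refine Monotone.directed_le (f := E) fun s t hst z => ?_
    rintro ⟨i, hi⟩
    exact ⟨⟨i, hst i.2⟩, hi⟩
  refine ENNReal.toReal_le_of_le_ofReal hδ.le ?_
  -- The finite bound does not depend on the size of the family, so it survives the increasing union
  -- over finite subfamilies.
  rw [hE, hdir.measure_iUnion]
  refine iSup_le fun s => ?_
  rcases s.eq_empty_or_nonempty with rfl | hs
  · have : E ∅ = ∅ := by
      ext z
      simp [E]
    simp [this]
  · have := hs.to_subtype
    rw [← ENNReal.ofReal_toReal (measure_ne_top _ (E s))]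
    exact ENNReal.ofReal_le_ofReal (measureReal_exists_empirical_gt_le_of_finite
      (h := fun i : s => h i) (f := fun i : s => f i) (fun i => hm i) (fun i => hb i)
      (fun i => hf i) (fun i => hfe i) hB he hJ (fun i j => hlip i j) hn hδ hδ')

end Deviation

/-! ### Evaluation, measurability and separability in vector-valued RKHSs -/

section VectorRKHS

open scoped RealInnerProductSpace

lemma norm_sum_sq_of_pairwise_inner_eq_zero {H : Type*} [NormedAddCommGroup H]
    [InnerProductSpace ℝ H] {n : ℕ} (g : Fin n → H)
    (h : ∀ i j, i ≠ j → ⟪g i, g j⟫ = 0) : ‖∑ i, g i‖ ^ 2 = ∑ i, ‖g i‖ ^ 2 := by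
  rw [← real_inner_self_eq_norm_sq, sum_inner]
  refine Finset.sum_congr rfl fun i _ => ?_
  rw [inner_sum, Finset.sum_eq_single i (fun j _ hj => h i j hj.symm) (by simp),
    real_inner_self_eq_norm_sq]

variable {X H : Type*} {m : ℕ} [NormedAddCommGroup H] [InnerProductSpace ℝ H] [CompleteSpace H]
  [RKHS ℝ H X (EuclideanSpace ℝ (Fin m))]

variable (H) in
/-- The kernel function at `x` in the direction of the `a`-th basis vector. -/
noncomputable def coordKer (x : X) (a : Fin m) : H :=
  RKHS.kerFun H x (EuclideanSpace.single a 1)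

lemma inner_coordKer (f : H) (x : X) (a : Fin m) : ⟪f, coordKer H x a⟫ = f x a := by
  simp [coordKer, EuclideanSpace.inner_single_right]

lemma kerFun_eq_sum_coordKer (x : X) (v : EuclideanSpace ℝ (Fin m)) :
    RKHS.kerFun H x v = ∑ a, v a • coordKer H x a := by
  refine ext_inner_left ℝ fun f => ?_
  rw [RKHS.inner_kerFun, inner_sum, PiLp.inner_apply]
  refine Finset.sum_congr rfl fun a _ => ?_
  rw [inner_smul_right, inner_coordKer]
  simp

lemma norm_eval_eq_sqrt (f : H) (x : X) : ‖f x‖ = √(∑ a, ⟪f, coordKer H x a⟫ ^ 2) := by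
  rw [EuclideanSpace.norm_eq]
  simp [inner_coordKer]

lemma norm_eval_le {B : ℝ} (hB : 0 ≤ B) {x : X} (he : ∑ a, ‖coordKer H x a‖ ^ 2 ≤ B ^ 2)
    (f : H) : ‖f x‖ ≤ B * ‖f‖ := by
  rw [norm_eval_eq_sqrt]
  refine Real.sqrt_le_iff.2 ⟨by positivity, ?_⟩
  calc ∑ a, ⟪f, coordKer H x a⟫ ^ 2 ≤ ∑ a, ‖f‖ ^ 2 * ‖coordKer H x a‖ ^ 2 :=
        Finset.sum_le_sum fun a _ => by
          rw [← mul_pow, ← sq_abs]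
          exact pow_le_pow_left₀ (abs_nonneg _) (abs_real_inner_le_norm _ _) 2
    _ = ‖f‖ ^ 2 * ∑ a, ‖coordKer H x a‖ ^ 2 := by rw [Finset.mul_sum]
    _ ≤ ‖f‖ ^ 2 * B ^ 2 := by gcongr
    _ = (B * ‖f‖) ^ 2 := by ring

lemma norm_kerFun_le {B : ℝ} (hB : 0 ≤ B) {x : X} (he : ∑ a, ‖coordKer H x a‖ ^ 2 ≤ B ^ 2)
    (v : EuclideanSpace ℝ (Fin m)) : ‖RKHS.kerFun H x v‖ ≤ B * ‖v‖ := by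
  rcases eq_or_ne (RKHS.kerFun H x v) 0 with h0 | h0
  · rw [h0, norm_zero]
    positivity
  · have h1 : ‖RKHS.kerFun H x v‖ * ‖RKHS.kerFun H x v‖ ≤
        ‖RKHS.kerFun H x v‖ * (B * ‖v‖) := by
      rw [← real_inner_self_eq_norm_mul_norm, RKHS.inner_kerFun]
      refine (real_inner_le_norm _ _).trans ?_
      have := mul_le_mul_of_nonneg_right (norm_eval_le hB he (RKHS.kerFun H x v)) (norm_nonneg v)
      linarith
    exact le_of_mul_le_mul_left h1 (norm_pos_iff.2 h0)

/-- If the components of the kernel functions at the sample points orthogonal to `K` are pairwise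
orthogonal, the component of `f` orthogonal to `K` is small on the sample. -/
lemma sum_norm_eval_sub_starProjection_le {n : ℕ} {B : ℝ} (hB : 0 ≤ B)
    (he : ∀ x : X, ∑ a, ‖coordKer H x a‖ ^ 2 ≤ B ^ 2) (K : Submodule ℝ H)
    [K.HasOrthogonalProjection] (x : Fin n → X)
    (hx : ∀ i j, i ≠ j → ∀ a b,
      ⟪K.starProjection (coordKer H (x i) a), coordKer H (x j) b⟫ =
        ⟪coordKer H (x i) a, coordKer H (x j) b⟫)
    (f : H) (hf : ‖f‖ ≤ 1) :
    ∑ i, ‖(f - K.starProjection f) (x i)‖ ≤ B * √n := by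
  set v : Fin n → EuclideanSpace ℝ (Fin m) := fun i => (f - K.starProjection f) (x i)
  set g : Fin n → H := fun i =>
    RKHS.kerFun H (x i) (v i) - K.starProjection (RKHS.kerFun H (x i) (v i))
  have hsymm : ∀ u u' : H, ⟪u - K.starProjection u, u'⟫ =
      ⟪u - K.starProjection u, u' - K.starProjection u'⟫ := by
    intro u u'
    rw [inner_sub_right (u - K.starProjection u) u' (K.starProjection u'),
      K.starProjection_inner_eq_zero u _ (K.starProjection_apply_mem u'), sub_zero]
  have horth : ∀ i j, i ≠ j → ⟪g i, g j⟫ = 0 := by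
    intro i j hij
    simp only [g]
    rw [← hsymm, kerFun_eq_sum_coordKer (x i), kerFun_eq_sum_coordKer (x j), map_sum,
      ← Finset.sum_sub_distrib, sum_inner]
    refine Finset.sum_eq_zero fun a _ => ?_
    rw [inner_sum]
    refine Finset.sum_eq_zero fun b _ => ?_
    rw [map_smul, ← smul_sub, inner_smul_left, inner_smul_right, inner_sub_left, hx i j hij]
    simp
  have hgle : ∀ i, ‖g i‖ ≤ B * ‖v i‖ := by
    intro i
    refine le_trans ?_ (norm_kerFun_le hB (he (x i)) (v i))
    have h1 := K.norm_sq_eq_add_norm_sq_starProjection (RKHS.kerFun H (x i) (v i))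
    rw [K.starProjection_orthogonal_val] at h1
    refine le_of_sq_le_sq ?_ (norm_nonneg _)
    have := sq_nonneg ‖K.starProjection (RKHS.kerFun H (x i) (v i))‖
    linarith
  -- By reproduction the left side is `f` paired with `∑ g i`. Orthogonality bounds the norm of that
  -- sum by `B (∑ ‖v i‖²)^{1/2}`, so `∑ ‖v i‖² ≤ B²` with no factor `n`.
  have hS : ∑ i, ‖v i‖ ^ 2 ≤ ‖∑ i, g i‖ := by
    calc ∑ i, ‖v i‖ ^ 2 = ⟪f, ∑ i, g i⟫ := by
          rw [inner_sum]
          refine Finset.sum_congr rfl fun i _ => ?_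
          have h1 : ⟪v i, v i⟫ = ⟪f - K.starProjection f, RKHS.kerFun H (x i) (v i)⟫ := by
            rw [RKHS.inner_kerFun]
          rw [← real_inner_self_eq_norm_sq, h1, hsymm, real_inner_comm, ← hsymm, real_inner_comm]
      _ ≤ ‖∑ i, g i‖ := (real_inner_le_norm _ _).trans (mul_le_of_le_one_left (norm_nonneg _) hf)
  have hS2 : (∑ i, ‖v i‖ ^ 2) ^ 2 ≤ B ^ 2 * ∑ i, ‖v i‖ ^ 2 := by
    calc (∑ i, ‖v i‖ ^ 2) ^ 2 ≤ ‖∑ i, g i‖ ^ 2 := pow_le_pow_left₀ (by positivity) hS 2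
      _ = ∑ i, ‖g i‖ ^ 2 := norm_sum_sq_of_pairwise_inner_eq_zero g horth
      _ ≤ ∑ i, (B * ‖v i‖) ^ 2 := Finset.sum_le_sum fun i _ =>
          pow_le_pow_left₀ (norm_nonneg _) (hgle i) 2
      _ = B ^ 2 * ∑ i, ‖v i‖ ^ 2 := by simp only [mul_pow, Finset.mul_sum]
  have hS3 : ∑ i, ‖v i‖ ^ 2 ≤ B ^ 2 := by
    rcases (Finset.sum_nonneg fun i _ => sq_nonneg ‖v i‖ : 0 ≤ ∑ i, ‖v i‖ ^ 2).eq_or_lt with h | h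
    · rw [← h]; positivity
    · exact le_of_mul_le_mul_right (by linarith [sq (∑ i, ‖v i‖ ^ 2)]) h
  have hcs : (∑ i, ‖v i‖) ^ 2 ≤ n * ∑ i, ‖v i‖ ^ 2 := by
    simpa using sq_sum_le_card_mul_sum_sq (s := Finset.univ) (f := fun i => ‖v i‖)
  refine (Real.le_sqrt_of_sq_le hcs).trans ?_
  rw [mul_comm B, Real.sqrt_mul (by positivity)]
  gcongr
  exact Real.sqrt_le_iff.2 ⟨hB, hS3⟩

variable [MeasurableSpace X]

/-- Kernel expansions are measurable and dense, and norm convergence implies pointwise convergence;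
a sequence suffices even when `H` is nonseparable. -/
lemma RKHS.measurable_coe
    (hK : ∀ a b, Measurable fun p : X × X => ⟪coordKer H p.1 a, coordKer H p.2 b⟫) (f : H) :
    Measurable f := by
  have hf : f ∈ (Submodule.span ℝ {RKHS.kerFun H x v | (x : X)
      (v : EuclideanSpace ℝ (Fin m))}).topologicalClosure := by
    rw [RKHS.kerFun_dense]; trivial
  have hspan : ∀ g ∈ Submodule.span ℝ {RKHS.kerFun H x v | (x : X)
      (v : EuclideanSpace ℝ (Fin m))}, Measurable (g : X → EuclideanSpace ℝ (Fin m)) := by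
    intro g hg
    induction hg using Submodule.span_induction with
    | mem g hg =>
      obtain ⟨y, v, rfl⟩ := hg
      refine (MeasurableEquiv.toLp 2 (Fin m → ℝ)).measurable.comp
        (f := fun x b => (RKHS.kerFun H y v) x b) (measurable_pi_iff.2 fun b => ?_)
      have : (fun x => (RKHS.kerFun H y v) x b) =
          fun x => ∑ a, v a * ⟪coordKer H y a, coordKer H x b⟫ := by
        funext x
        rw [← inner_coordKer, kerFun_eq_sum_coordKer, sum_inner]
        simp [inner_smul_left]
      rw [this]
      exact Finset.measurable_sum _ fun a _ =>
        ((hK a b).comp measurable_prodMk_left).const_mul _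
    | zero => rw [RKHS.coe_zero]; exact measurable_const
    | add g g' _ _ h h' => rw [RKHS.coe_add]; exact h.add h'
    | smul c g _ h => rw [RKHS.coe_smul]; exact h.const_smul c
  obtain ⟨u, hu, hlim⟩ := mem_closure_iff_seq_limit.1 hf
  refine measurable_of_tendsto_metrizable (fun n => hspan _ (hu n)) (tendsto_pi_nhds.2 fun x => ?_)
  exact ((RKHS.continuous_eval x).tendsto f).comp hlim

/-- Up to functions vanishing almost everywhere, a vector-valued RKHS with a bounded jointly
measurable kernel is separable. -/
lemma exists_separable_submodule {B : ℝ} (ρ : Measure X) [IsProbabilityMeasure ρ]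
    (hK : ∀ a b, Measurable fun p : X × X => ⟪coordKer H p.1 a, coordKer H p.2 b⟫)
    (hB : 0 ≤ B) (he : ∀ x, ∑ a, ‖coordKer H x a‖ ^ 2 ≤ B ^ 2) :
    ∃ (K : Submodule ℝ H) (_ : K.HasOrthogonalProjection),
      TopologicalSpace.IsSeparable (K : Set H) ∧ (∀ f ∈ Kᗮ, ∀ᵐ x ∂ρ, f x = 0) ∧
      ∀ a b, Measurable fun p : X × X => ⟪K.starProjection (coordKer H p.1 a), coordKer H p.2 b⟫ := by
  obtain ⟨w, b, -⟩ := exists_hilbertBasis ℝ H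
  have hmeas : ∀ f : H, Measurable f := RKHS.measurable_coe hK
  have hsq_int : ∀ i, Integrable (fun x => ‖b i x‖ ^ 2) ρ := fun i =>
    integrable_of_abs_le (C := B ^ 2) ((hmeas _).norm.pow_const 2) fun x => by
      rw [abs_of_nonneg (by positivity)]
      have := norm_eval_le hB (he x) (b i)
      rw [b.orthonormal.1 i, mul_one] at this
      exact pow_le_pow_left₀ (norm_nonneg _) this 2
  -- Bessel's inequality for the kernel functions at `x`, integrated in `x`. The resulting
  -- summability leaves only countably many basis elements that are not null.
  have hsum : ∀ s : Finset w, ∑ i ∈ s, ∫ x, ‖b i x‖ ^ 2 ∂ρ ≤ B ^ 2 := by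
    intro s
    rw [← integral_finsetSum _ fun i _ => hsq_int i]
    refine (integral_mono (g := fun _ => B ^ 2) (integrable_finsetSum _ fun i _ => hsq_int i)
      (integrable_const _) fun x => ?_).trans_eq (by simp)
    refine le_trans ?_ (he x)
    calc ∑ i ∈ s, ‖b i x‖ ^ 2 = ∑ i ∈ s, ∑ a, ‖⟪b i, coordKer H x a⟫‖ ^ 2 := by
          refine Finset.sum_congr rfl fun i _ => ?_
          rw [norm_eval_eq_sqrt, Real.sq_sqrt (by positivity)]
          simp
      _ = ∑ a, ∑ i ∈ s, ‖⟪b i, coordKer H x a⟫‖ ^ 2 := Finset.sum_comm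
      _ ≤ ∑ a, ‖coordKer H x a‖ ^ 2 :=
          Finset.sum_le_sum fun a _ => b.orthonormal.sum_inner_products_le _
  set I : Set w := Function.support fun i => ∫ x, ‖b i x‖ ^ 2 ∂ρ
  have hI : I.Countable := (summable_of_sum_le (fun i => integral_nonneg fun x => by positivity)
    hsum).countable_support
  have hzero : ∀ i ∉ I, ∀ᵐ x ∂ρ, b i x = 0 := by
    intro i hi
    have h0 : ∫ x, ‖b i x‖ ^ 2 ∂ρ = 0 := by simpa [I] using hi
    rw [integral_eq_zero_iff_of_nonneg (fun x => by positivity) (hsq_int i)] at h0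
    filter_upwards [h0] with x hx
    simpa using hx
  set K : Submodule ℝ H := (Submodule.span ℝ (b '' I)).topologicalClosure
  have hbK : ∀ i ∈ I, b i ∈ K := fun i hi =>
    Submodule.le_topologicalClosure _ (Submodule.subset_span ⟨i, hi, rfl⟩)
  have hbK' : ∀ i ∉ I, ∀ g ∈ K, ⟪b i, g⟫ = 0 := by
    intro i hi g hg
    have : K ≤ (ℝ ∙ b i)ᗮ := by
      refine Submodule.topologicalClosure_minimal _ (Submodule.span_le.2 ?_)
        (Submodule.isClosed_orthogonal _)
      rintro _ ⟨j, hj, rfl⟩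
      refine Submodule.mem_orthogonal_singleton_iff_inner_right.2 (b.orthonormal.2 ?_)
      rintro rfl
      exact hi hj
    exact Submodule.mem_orthogonal_singleton_iff_inner_right.1 (this hg)
  refine ⟨K, inferInstance, ?_, ?_, ?_⟩
  · exact ((hI.image b).isSeparable.span).closure
  · intro f hf
    -- A given `f` has countably many nonzero coefficients, so the null sets of the basis elements
    -- involved can be united.
    set s : Set w := Function.support fun i => b.repr f i
    have hsumf := b.hasSum_repr f
    have hs : s.Countable := by
      refine (b.summable_inner_mul_inner f f).countable_support.mono fun i hi => ?_
      simp only [s, Function.mem_support, b.repr_apply_apply] at hi ⊢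
      rw [real_inner_comm]
      exact mul_ne_zero hi hi
    have hsI : ∀ i ∈ s, i ∉ I := by
      intro i hi hiI
      refine hi ?_
      simp only [b.repr_apply_apply]
      exact hf _ (hbK i hiI)
    have hae : ∀ᵐ x ∂ρ, ∀ i ∈ s, b i x = 0 :=
      (ae_ball_iff hs).2 fun i hi => hzero i (hsI i hi)
    filter_upwards [hae] with x hx
    have h1 : HasSum (fun i => (RKHS.coeCLM ℝ (b.repr f i • b i) : X → _) x) (f x) :=
      hsumf.map ((Pi.evalAddMonoidHom _ x).comp (RKHS.coeCLM ℝ (H := H)).toLinearMap.toAddMonoidHom)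
        (RKHS.continuous_eval x)
    refine h1.unique ?_
    convert hasSum_zero using 2 with i
    by_cases hi : i ∈ s
    · simp [hx i hi]
    · have : b.repr f i = 0 := by simpa [s] using hi
      simp [this]
  · intro a c
    have hsub : Countable I := hI.to_subtype
    -- Projection onto `K` reduces the Parseval series to the countable index set `I`, which makes
    -- the projected kernel a limit of measurable finite sums.
    have hp : ∀ p : X × X, HasSum
        (fun i : I => ⟪coordKer H p.1 a, b i⟫ * ⟪b i, coordKer H p.2 c⟫)
        ⟪K.starProjection (coordKer H p.1 a), coordKer H p.2 c⟫ := by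
      intro p
      have h1 := b.hasSum_inner_mul_inner (K.starProjection (coordKer H p.1 a)) (coordKer H p.2 c)
      rw [← hasSum_subtype_iff_of_support_subset (s := I)] at h1
      · have hfun : (fun i : I => ⟪coordKer H p.1 a, b i⟫ * ⟪b i, coordKer H p.2 c⟫) =
            (fun i => ⟪K.starProjection (coordKer H p.1 a), b i⟫ * ⟪b i, coordKer H p.2 c⟫) ∘
              Subtype.val := by
          funext i
          change _ = ⟪K.starProjection (coordKer H p.1 a), b i⟫ * ⟪b i, coordKer H p.2 c⟫
          rw [Submodule.inner_starProjection_left_eq_right,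
            Submodule.starProjection_eq_self_iff.2 (hbK i i.2)]
        rw [hfun]
        exact h1
      · intro i hi
        by_contra hiI
        refine hi ?_
        change ⟪K.starProjection (coordKer H p.1 a), b i⟫ * ⟪b i, coordKer H p.2 c⟫ = 0
        rw [real_inner_comm, hbK' i hiI _ (Submodule.starProjection_apply_mem _ _), zero_mul]
    refine measurable_of_tendsto_metrizable' Filter.atTop
      (f := fun (t : Finset I) (p : X × X) =>
        ∑ i ∈ t, ⟪coordKer H p.1 a, b i⟫ * ⟪b i, coordKer H p.2 c⟫) (fun t => ?_)
      (tendsto_pi_nhds.2 fun p => hp p)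
    refine Finset.measurable_sum _ fun i _ => ?_
    simp only [real_inner_comm (b i), inner_coordKer]
    have h1 := hmeas (b i)
    fun_prop

end VectorRKHS

/-! ### Statistical dimension and spectral norm estimates -/

section Spectral

/-- The zero-based columns from `statDim μ` on start one place after the first eigenvalue below the
threshold; monotonicity covers them. If no eigenvalue is below it, there are no such columns. -/
lemma statDim_spec {n : ℕ} {μ : Fin n → ℝ} (hμ : Antitone μ) (j : Fin n)
    (hj : statDim μ ≤ (j : ℕ)) : μ j ≤ criticalRadiusSq μ := by
  unfold statDim at hj
  split_ifs at hj with h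
  · obtain ⟨i, hi⟩ := h
    obtain ⟨i, hi, hi'⟩ := Nat.sInf_mem
      (⟨_, i, rfl, hi⟩ : {d : ℕ | ∃ j : Fin n, d = (j : ℕ) + 1 ∧ μ j ≤ criticalRadiusSq μ}.Nonempty)
    rw [hi] at hj
    exact (hμ (Fin.le_def.2 (by omega))).trans hi'
  · exact absurd j.2 (not_lt.2 hj)

lemma criticalRadiusSq_nonneg {n : ℕ} (μ : Fin n → ℝ) : 0 ≤ criticalRadiusSq μ :=
  Real.sInf_nonneg fun _ ht => ht.1.le

lemma EuclideanSpace.inner_toLp_eq_sum {p : Type*} [Fintype p] (v w : p → ℝ) :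
    inner ℝ (WithLp.toLp 2 v) (WithLp.toLp 2 w) = ∑ i, v i * w i := by
  simp [PiLp.inner_apply, mul_comm]

lemma EuclideanSpace.norm_toLp_sq {p : Type*} [Fintype p] (v : p → ℝ) :
    ‖WithLp.toLp 2 v‖ ^ 2 = ∑ i, v i ^ 2 := by
  simp [EuclideanSpace.norm_sq_eq]

variable {p q : Type*} [Fintype p] [Fintype q] [DecidableEq q]

lemma sum_mulVec_sq_le (C : Matrix p q ℝ) (v : q → ℝ) :
    ∑ i, (C *ᵥ v) i ^ 2 ≤ ‖C‖ ^ 2 * ∑ j, v j ^ 2 := by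
  have h : ‖WithLp.toLp 2 (C *ᵥ v)‖ ≤ ‖C‖ * ‖WithLp.toLp 2 v‖ :=
    C.l2_opNorm_mulVec (WithLp.toLp 2 v)
  rw [← EuclideanSpace.norm_toLp_sq, ← EuclideanSpace.norm_toLp_sq, ← mul_pow]
  exact pow_le_pow_left₀ (norm_nonneg _) h 2

lemma sum_mul_mulVec_le [DecidableEq p] (C : Matrix p p ℝ) (v : p → ℝ) :
    |∑ i, v i * (C *ᵥ v) i| ≤ ‖C‖ * ∑ j, v j ^ 2 := by
  rw [← EuclideanSpace.inner_toLp_eq_sum, ← EuclideanSpace.norm_toLp_sq]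
  refine (abs_real_inner_le_norm _ _).trans ?_
  have h : ‖WithLp.toLp 2 (C *ᵥ v)‖ ≤ ‖C‖ * ‖WithLp.toLp 2 v‖ :=
    C.l2_opNorm_mulVec (WithLp.toLp 2 v)
  have := mul_le_mul_of_nonneg_left h (norm_nonneg (WithLp.toLp 2 v))
  nlinarith

/-- A Gram matrix within 1/2 of the identity keeps at least half of each squared length. -/
lemma sum_sq_le_two_mul_of_norm_sub_one_le (A : Matrix p q ℝ) (hA : ‖Aᵀ * A - 1‖ ≤ 1 / 2)
    (v : q → ℝ) : ∑ j, v j ^ 2 ≤ 2 * ∑ i, (A *ᵥ v) i ^ 2 := by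
  have h1 := (abs_le.1 (sum_mul_mulVec_le (Aᵀ * A - 1) v)).1
  have h2 : ∑ j, v j * ((Aᵀ * A - 1) *ᵥ v) j = ∑ i, (A *ᵥ v) i ^ 2 - ∑ j, v j ^ 2 := by
    change v ⬝ᵥ ((Aᵀ * A - 1) *ᵥ v) = _
    rw [Matrix.sub_mulVec, dotProduct_sub, Matrix.one_mulVec, ← Matrix.mulVec_mulVec,
      Matrix.dotProduct_mulVec, Matrix.vecMul_transpose]
    simp only [dotProduct, sq]
  have h3 : ‖Aᵀ * A - 1‖ * ∑ j, v j ^ 2 ≤ 1 / 2 * ∑ j, v j ^ 2 :=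
    mul_le_mul_of_nonneg_right hA (Finset.sum_nonneg fun _ _ => sq_nonneg _)
  linarith

lemma sum_transpose_mulVec_sq_le [DecidableEq p] (C : Matrix p q ℝ) {b : ℝ} (hC : ‖C‖ ≤ b) (v : p → ℝ) :
    ∑ j, (Cᵀ *ᵥ v) j ^ 2 ≤ b ^ 2 * ∑ i, v i ^ 2 := by
  refine (sum_mulVec_sq_le Cᵀ v).trans (mul_le_mul_of_nonneg_right ?_
    (Finset.sum_nonneg fun _ _ => sq_nonneg _))
  have : ‖Cᵀ‖ = ‖C‖ := by rw [← Matrix.l2_opNorm_conjTranspose C,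
    Matrix.conjTranspose_eq_transpose_of_trivial]
  rw [this]
  exact pow_le_pow_left₀ (norm_nonneg _) hC 2

lemma le_of_sq_le_mul {a b : ℝ} (ha : 0 ≤ a) (hb : 0 ≤ b) (h : a ^ 2 ≤ b * a) : a ≤ b := by
  rcases ha.eq_or_lt with rfl | ha
  · exact hb
  · exact le_of_mul_le_mul_right (by linarith [sq a]) ha

end Spectral

/-! ### Vectors annihilated by a satisfiable sketch -/

section Approximation

variable {n s : ℕ} {ι : Type*} [Fintype ι]

/-- Key estimate for sketching: values annihilated by a satisfiable sketch, in the eigenbasis, are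
small when they are dominated by the kernel. -/
lemma sum_sq_le_of_isSatisfiable {U : Matrix (Fin n) (Fin n) ℝ} {μ : Fin n → ℝ}
    (hμ : Antitone μ) (hμ0 : ∀ j, 0 ≤ μ j) {S : Matrix (Fin s) (Fin n) ℝ} {c : ℝ}
    (hS : IsSatisfiable U μ S c) {V : Matrix (Fin n) ι ℝ} (hV : S * U * V = 0) {L : ℝ}
    (hL : 0 ≤ L)
    (hdual : ∀ W : Matrix (Fin n) ι ℝ,
      (∑ j, ∑ a, W j a * V j a) ^ 2 ≤ L * ∑ j, ∑ a, μ j * W j a ^ 2) :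
    ∑ j, ∑ a, V j a ^ 2 ≤ (1 + 2 * c ^ 2) * (L * criticalRadiusSq μ) := by
  set d := statDim μ
  set r := criticalRadiusSq μ
  have hr : 0 ≤ r := criticalRadiusSq_nonneg μ
  set B := S * U
  set B₁ := S * leftBlock U d
  set B₂ := S * rightBlock U d
  have hB₁ : ∀ t (j : {j : Fin n // (j : ℕ) < d}), B₁ t j = B t j := fun t j => rfl
  have hB₂ : ∀ t (j : {j : Fin n // d ≤ (j : ℕ)}), B₂ t j = B t j := fun t j => rfl
  have hsplit : ∀ g : Fin n → ℝ, ∑ j, g j =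
      ∑ j : {j : Fin n // (j : ℕ) < d}, g j + ∑ j : {j : Fin n // d ≤ (j : ℕ)}, g j := by
    intro g
    rw [← Fintype.sum_subtype_add_sum_subtype (fun j : Fin n => (j : ℕ) < d) g]
    congr 1
    exact Fintype.sum_equiv (Equiv.subtypeEquivRight fun j => not_lt) _ _ fun _ => rfl
  -- `Q` is the image of the high-frequency block; since the sketch annihilates `V`, the
  -- low-frequency block has image `-Q`.
  set Q : Matrix (Fin s) ι ℝ := fun t a => ∑ j : {j : Fin n // d ≤ (j : ℕ)}, B t j * V j a
  have hQ : ∀ t a, ∑ j : {j : Fin n // (j : ℕ) < d}, B t j * V j a = - Q t a := by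
    intro t a
    have h : (B * V) t a = 0 := by rw [hV]; rfl
    rw [Matrix.mul_apply, hsplit] at h
    linarith
  -- the low-frequency part
  have hlow : ∑ j : {j : Fin n // (j : ℕ) < d}, ∑ a, V j a ^ 2 ≤ 2 * ∑ t, ∑ a, Q t a ^ 2 := by
    rw [Finset.sum_comm (s := (Finset.univ : Finset {j : Fin n // (j : ℕ) < d})),
      Finset.sum_comm (s := (Finset.univ : Finset (Fin s))), Finset.mul_sum]
    refine Finset.sum_le_sum fun a _ => ?_
    have h := sum_sq_le_two_mul_of_norm_sub_one_le B₁ hS.1 fun j => V j a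
    refine h.trans_eq ?_
    congr 1
    refine Finset.sum_congr rfl fun t _ => ?_
    rw [← neg_sq (Q t a), ← hQ]
    rfl
  -- the leakage of the high-frequency part through the sketch
  have hleak : ∑ t, ∑ a, Q t a ^ 2 ≤ L * (c ^ 2 * r) := by
    classical
    -- The dual bound tested with the adjoint of the high block applied to `Q`: the pairing becomes
    -- `‖Q‖²`, and the weights `μ j` assemble the factor `D₂^{1/2}` of the satisfiability condition.
    set W : Matrix (Fin n) ι ℝ := fun j a => if d ≤ (j : ℕ) then ∑ t, B t j * Q t a else 0
    have hW₂ : ∀ (j : {j : Fin n // d ≤ (j : ℕ)}) a, W j a = ∑ t, B t j * Q t a := fun j a =>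
      if_pos j.2
    have hW₁ : ∀ (j : {j : Fin n // (j : ℕ) < d}) a, W j a = 0 := fun j a =>
      if_neg (not_le.2 j.2)
    have h1 := hdual W
    have h2 : ∑ j, ∑ a, W j a * V j a = ∑ t, ∑ a, Q t a ^ 2 := by
      rw [hsplit]
      simp only [hW₁, hW₂, zero_mul, Finset.sum_const_zero, zero_add]
      rw [Finset.sum_comm (s := (Finset.univ : Finset {j : Fin n // d ≤ (j : ℕ)})),
        Finset.sum_comm (s := (Finset.univ : Finset (Fin s)))]
      refine Finset.sum_congr rfl fun a _ => ?_
      simp only [Finset.sum_mul]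
      rw [Finset.sum_comm]
      refine Finset.sum_congr rfl fun t _ => ?_
      rw [sq]
      conv_rhs => rw [show Q t a = ∑ j : {j : Fin n // d ≤ (j : ℕ)}, B t j * V j a from rfl]
      rw [Finset.sum_mul]
      exact Finset.sum_congr rfl fun j _ => by ring
    have h3 : ∑ j, ∑ a, μ j * W j a ^ 2 ≤ (c ^ 2 * r) * ∑ t, ∑ a, Q t a ^ 2 := by
      rw [hsplit]
      simp only [hW₁, hW₂]
      simp only [ne_eq, OfNat.ofNat_ne_zero, not_false_eq_true, zero_pow, mul_zero,
        Finset.sum_const_zero, zero_add]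
      rw [Finset.sum_comm (s := (Finset.univ : Finset {j : Fin n // d ≤ (j : ℕ)})),
        Finset.sum_comm (s := (Finset.univ : Finset (Fin s))), Finset.mul_sum]
      refine Finset.sum_le_sum fun a _ => ?_
      have h := sum_transpose_mulVec_sq_le _ hS.2 fun t => Q t a
      rw [mul_pow, Real.sq_sqrt hr] at h
      refine le_trans (le_of_eq ?_) h
      refine Finset.sum_congr rfl fun j _ => ?_
      have h4 : ((B₂ * Matrix.diagonal fun j : {j : Fin n // d ≤ (j : ℕ)} => √(μ j))ᵀ *ᵥ
          fun t => Q t a) j = √(μ j) * ∑ t, B t j * Q t a := by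
        simp only [Matrix.mulVec, dotProduct, Matrix.transpose_apply, Matrix.mul_diagonal, hB₂]
        rw [Finset.mul_sum]
        exact Finset.sum_congr rfl fun t _ => by ring
      rw [h4, mul_pow, Real.sq_sqrt (hμ0 _)]
    rw [h2] at h1
    refine le_of_sq_le_mul (by positivity) (by positivity) (h1.trans ?_)
    rw [mul_assoc]
    exact mul_le_mul_of_nonneg_left h3 hL
  -- the high-frequency part
  have hhigh : ∑ j : {j : Fin n // d ≤ (j : ℕ)}, ∑ a, V j a ^ 2 ≤ L * r := by
    classical
    -- Tested with the high-frequency part of `V` itself, whose eigenvalues are at most the squared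
    -- critical radius.
    set W : Matrix (Fin n) ι ℝ := fun j a => if d ≤ (j : ℕ) then V j a else 0
    have hW₂ : ∀ (j : {j : Fin n // d ≤ (j : ℕ)}) a, W j a = V j a := fun j a => if_pos j.2
    have hW₁ : ∀ (j : {j : Fin n // (j : ℕ) < d}) a, W j a = 0 := fun j a =>
      if_neg (not_le.2 j.2)
    have h1 := hdual W
    rw [hsplit, hsplit] at h1
    simp only [hW₁, hW₂] at h1
    simp only [ne_eq, OfNat.ofNat_ne_zero, not_false_eq_true, zero_pow, mul_zero, zero_mul,
      Finset.sum_const_zero, zero_add, ← sq] at h1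
    refine le_of_sq_le_mul (by positivity) (by positivity) (h1.trans ?_)
    rw [mul_assoc]
    refine mul_le_mul_of_nonneg_left ?_ hL
    rw [Finset.mul_sum]
    refine Finset.sum_le_sum fun j _ => ?_
    rw [Finset.mul_sum]
    exact Finset.sum_le_sum fun a _ =>
      mul_le_mul_of_nonneg_right (statDim_spec hμ j j.2) (sq_nonneg _)
  rw [hsplit]
  linarith

end Approximation

/-! ### Kernel expansions and projection onto sketched functions -/

section Sketch

open scoped RealInnerProductSpace

variable {X H : Type*} {m n s : ℕ} [NormedAddCommGroup H] [InnerProductSpace ℝ H] [CompleteSpace H]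
  [RKHS ℝ H X (EuclideanSpace ℝ (Fin m))] {k : X → X → ℝ} {M : Matrix (Fin m) (Fin m) ℝ}

lemma eigenvalue_nonneg (hk : IsScalarKernel k) {x : Fin n → X} {U : Matrix (Fin n) (Fin n) ℝ}
    {μ : Fin n → ℝ} (hU : IsEigendecomposition ((1 / (n : ℝ)) • gramMatrix k x) U μ)
    (j : Fin n) : 0 ≤ μ j := by
  have hUU : Uᵀ * U = 1 := (Matrix.mem_orthogonalGroup_iff' (Fin n) ℝ).1 hU.orthogonal
  have h : Uᵀ * ((1 / (n : ℝ)) • gramMatrix k x) * U = Matrix.diagonal μ := by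
    rw [hU.eq, ← Matrix.mul_assoc, ← Matrix.mul_assoc, hUU, Matrix.one_mul, Matrix.mul_assoc, hUU,
      Matrix.mul_one]
  have h2 : μ j = 1 / (n : ℝ) * ∑ i, ∑ l, U i j * k (x i) (x l) * U l j := by
    have := congrFun (congrFun h j) j
    rw [Matrix.diagonal_apply_eq] at this
    rw [← this, Matrix.mul_smul, Matrix.smul_mul, Matrix.smul_apply, smul_eq_mul]
    congr 1
    rw [Matrix.mul_assoc, Matrix.mul_apply]
    refine Finset.sum_congr rfl fun i _ => ?_
    rw [Matrix.mul_apply, Finset.mul_sum]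
    exact Finset.sum_congr rfl fun l _ => by simp [gramMatrix, mul_assoc]
  rw [h2]
  exact mul_nonneg (by positivity) (hk.nonneg n x fun i => U i j)

lemma inner_coordKer_coordKer (hH : HasDecomposableKernel H k M) (x x' : X) (a b : Fin m) :
    ⟪coordKer H x a, coordKer H x' b⟫ = k x x' * M a b := by
  rw [coordKer, RKHS.kerFun_inner, coordKer, RKHS.kerFun_apply, hH]
  simp [EuclideanSpace.inner_single_left, Matrix.ofLp_toEuclideanCLM]

/-- The kernel expansion `∑ⱼ K(·, xⱼ) wⱼ` with coefficients the rows of `w`. -/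
lemma sum_kerFun_eq (x : Fin n → X) (w : Matrix (Fin n) (Fin m) ℝ) :
    ∑ j, RKHS.kerFun H (x j) (WithLp.toLp 2 (w.row j)) = ∑ j, ∑ a, w j a • coordKer H (x j) a := by
  simp [kerFun_eq_sum_coordKer, Matrix.row]

lemma inner_sum_kerFun (x : Fin n → X) (w : Matrix (Fin n) (Fin m) ℝ) (r : H) :
    ⟪r, ∑ j, RKHS.kerFun H (x j) (WithLp.toLp 2 (w.row j))⟫ = ∑ j, ∑ a, w j a * r (x j) a := by
  rw [sum_kerFun_eq]
  simp [inner_sum, inner_smul_right, inner_coordKer]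

lemma sum_kerFun_apply (hM : M.IsHermitian) (hH : HasDecomposableKernel H k M) (x : Fin n → X)
    (w : Matrix (Fin n) (Fin m) ℝ) (i : Fin n) :
    (∑ j, RKHS.kerFun H (x j) (WithLp.toLp 2 (w.row j))) (x i) =
      WithLp.toLp 2 ((gramMatrix k x * w * M).row i) := by
  ext b
  rw [← inner_coordKer, sum_kerFun_eq, sum_inner]
  have hk : ∀ j a, ⟪coordKer H (x j) a, coordKer H (x i) b⟫ = k (x i) (x j) * M a b := by
    intro j a
    rw [real_inner_comm, inner_coordKer_coordKer hH]
    have := hM.apply a b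
    simp only [star_trivial] at this
    rw [this]
  simp only [sum_inner, inner_smul_left, hk, Matrix.row, Matrix.mul_apply, gramMatrix,
    Matrix.of_apply, Finset.sum_mul]
  rw [Finset.sum_comm]
  refine Finset.sum_congr rfl fun a _ => Finset.sum_congr rfl fun j _ => ?_
  simp only [conj_trivial]
  ring

lemma norm_sum_kerFun_sq (hM : M.IsHermitian) (hH : HasDecomposableKernel H k M) (x : Fin n → X)
    (w : Matrix (Fin n) (Fin m) ℝ) :
    ‖∑ j, RKHS.kerFun H (x j) (WithLp.toLp 2 (w.row j))‖ ^ 2 =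
      (gramMatrix k x * w * M * wᵀ).trace := by
  rw [← real_inner_self_eq_norm_sq, inner_sum_kerFun]
  simp only [sum_kerFun_apply hM hH]
  simp only [Matrix.trace, Matrix.diag_apply, Matrix.mul_apply (N := wᵀ), Matrix.transpose_apply]
  exact Finset.sum_congr rfl fun j _ => Finset.sum_congr rfl fun a _ => mul_comm _ _

/-- In the eigenbasis the squared norm is `n` times the `μ`-weighted sum of the quadratic form of
`M` on the rows of `W`; the factor `n` undoes the normalization of the Gram matrix. -/
lemma norm_sum_kerFun_sq_le (hk : IsScalarKernel k) (hM : M.IsHermitian)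
    (hH : HasDecomposableKernel H k M) {x : Fin n → X} {U : Matrix (Fin n) (Fin n) ℝ}
    {μ : Fin n → ℝ} (hU : IsEigendecomposition ((1 / (n : ℝ)) • gramMatrix k x) U μ)
    (W : Matrix (Fin n) (Fin m) ℝ) :
    ‖∑ j, RKHS.kerFun H (x j) (WithLp.toLp 2 ((U * W).row j))‖ ^ 2 ≤
      (n * ‖M‖) * ∑ j, ∑ a, μ j * W j a ^ 2 := by
  rcases Nat.eq_zero_or_pos n with rfl | hn
  · simp
  have hUU : Uᵀ * U = 1 := (Matrix.mem_orthogonalGroup_iff' (Fin n) ℝ).1 hU.orthogonal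
  have hn' : (n : ℝ) ≠ 0 := by positivity
  have hG : gramMatrix k x = (n : ℝ) • (U * Matrix.diagonal μ * Uᵀ) := by
    rw [← hU.eq, smul_smul, mul_one_div_cancel hn', one_smul]
  have h1 : (gramMatrix k x * (U * W) * M * (U * W)ᵀ).trace =
      n * (Matrix.diagonal μ * (W * M * Wᵀ)).trace := by
    rw [hG, Matrix.transpose_mul]
    simp only [Matrix.smul_mul, Matrix.trace_smul, smul_eq_mul]
    congr 1
    have h2 : U * Matrix.diagonal μ * Uᵀ * (U * W) * M * (Wᵀ * Uᵀ) =
        U * (Matrix.diagonal μ * (W * M * Wᵀ) * Uᵀ) := by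
      simp only [Matrix.mul_assoc]
      rw [← Matrix.mul_assoc Uᵀ U, hUU, Matrix.one_mul]
    rw [h2, Matrix.trace_mul_comm, Matrix.mul_assoc, hUU, Matrix.mul_one]
  rw [norm_sum_kerFun_sq hM hH, h1, mul_assoc]
  refine mul_le_mul_of_nonneg_left ?_ (by positivity)
  rw [Finset.mul_sum]
  simp only [Matrix.trace, Matrix.diag_apply, Matrix.diagonal_mul]
  refine Finset.sum_le_sum fun j _ => ?_
  rw [← Finset.mul_sum, mul_left_comm]
  refine mul_le_mul_of_nonneg_left ?_ (eigenvalue_nonneg hk hU j)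
  refine le_trans (le_of_eq ?_) ((le_abs_self _).trans (sum_mul_mulVec_le M (W j)))
  have : W j ⬝ᵥ (M *ᵥ W j) = W j ᵥ* M ⬝ᵥ W j := Matrix.dotProduct_mulVec _ _ _
  exact this.symm

variable (H) in
/-- The sketched functions depend linearly on the parameter. -/
noncomputable def sketchedLinearMap (x : Fin n → X) (S : Matrix (Fin s) (Fin n) ℝ) :
    Matrix (Fin s) (Fin m) ℝ →ₗ[ℝ] H where
  toFun Γ := sketchedFunction H x S Γ
  map_add' Γ Γ' := by
    simp only [sketchedFunction, sum_kerFun_eq, Matrix.mul_add, Matrix.add_apply, add_smul,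
      Finset.sum_add_distrib]
  map_smul' b Γ := by
    simp only [sketchedFunction, sum_kerFun_eq, Matrix.mul_smul, Matrix.smul_apply, smul_eq_mul,
      mul_smul, Finset.smul_sum, RingHom.id_apply]

/-- Approximation of an element of the unit ball by sketched functions of the unit ball. -/
lemma exists_sketchedFunction_approx (hk : IsScalarKernel k) (hM : M.IsHermitian)
    (hH : HasDecomposableKernel H k M) {x : Fin n → X} {U : Matrix (Fin n) (Fin n) ℝ}
    {μ : Fin n → ℝ} (hU : IsEigendecomposition ((1 / (n : ℝ)) • gramMatrix k x) U μ)
    {S : Matrix (Fin s) (Fin n) ℝ} {c : ℝ} (hS : IsSatisfiable U μ S c) (f : H) (hf : ‖f‖ ≤ 1) :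
    ∃ Γ : Matrix (Fin s) (Fin m) ℝ, ‖sketchedFunction H x S Γ‖ ≤ 1 ∧
      ∑ i, ‖sketchedFunction H x S Γ (x i) - f (x i)‖ ^ 2 ≤
        (1 + 2 * c ^ 2) * (n * ‖M‖ * criticalRadiusSq μ) := by
  -- The projection contracts the norm, so the competitor is feasible; the range is
  -- finite-dimensional, so the projection exists.
  set K := LinearMap.range (sketchedLinearMap H x S)
  obtain ⟨Γ, hΓ⟩ : K.starProjection f ∈ K := K.starProjection_apply_mem f
  have hΓ' : sketchedFunction H x S Γ = K.starProjection f := hΓ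
  refine ⟨Γ, ?_, ?_⟩
  · rw [hΓ']
    exact (K.norm_starProjection_apply_le f).trans hf
  set r := f - K.starProjection f
  have hr : ‖r‖ ≤ 1 := by
    have h1 := K.norm_sq_eq_add_norm_sq_starProjection f
    rw [K.starProjection_orthogonal_val] at h1
    have h2 := sq_nonneg ‖K.starProjection f‖
    have h3 : ‖r‖ ^ 2 ≤ 1 ^ 2 := by
      have := pow_le_pow_left₀ (norm_nonneg f) hf 2
      linarith
    exact le_of_sq_le_sq h3 zero_le_one
  set R : Matrix (Fin n) (Fin m) ℝ := fun j a => r (x j) a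
  -- Orthogonality to the sketched function with parameter `S * R` is the vanishing of the squared
  -- Frobenius norm of `S * R`.
  have hSR : S * R = 0 := by
    have h0 : ⟪r, sketchedFunction H x S (S * R)⟫ = 0 :=
      K.starProjection_inner_eq_zero f _ ⟨S * R, rfl⟩
    rw [sketchedFunction, inner_sum_kerFun] at h0
    have h1 : ∑ j, ∑ a, (Sᵀ * (S * R)) j a * r (x j) a = ∑ t, ∑ a, (S * R) t a ^ 2 := by
      rw [Finset.sum_comm (s := (Finset.univ : Finset (Fin n))),
        Finset.sum_comm (s := (Finset.univ : Finset (Fin s)))]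
      refine Finset.sum_congr rfl fun a _ => ?_
      simp only [Matrix.mul_apply (M := Sᵀ), Matrix.transpose_apply, Finset.sum_mul]
      rw [Finset.sum_comm]
      refine Finset.sum_congr rfl fun t _ => ?_
      rw [sq]
      conv_rhs => enter [2]; rw [Matrix.mul_apply]
      rw [Finset.mul_sum]
      exact Finset.sum_congr rfl fun j _ => by simp only [R]; ring
    rw [h1] at h0
    ext t a
    have h2 := (Finset.sum_eq_zero_iff_of_nonneg fun t _ => Finset.sum_nonneg fun a _ =>
      sq_nonneg ((S * R) t a)).1 h0 t (Finset.mem_univ t)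
    have h3 := (Finset.sum_eq_zero_iff_of_nonneg fun a _ => sq_nonneg ((S * R) t a)).1 h2 a
      (Finset.mem_univ a)
    simpa using h3
  have hUU : Uᵀ * U = 1 := (Matrix.mem_orthogonalGroup_iff' (Fin n) ℝ).1 hU.orthogonal
  have hUU' : U * Uᵀ = 1 := (Matrix.mem_orthogonalGroup_iff (Fin n) ℝ).1 hU.orthogonal
  set V := Uᵀ * R
  have hV : S * U * V = 0 := by
    simp only [V]
    rw [Matrix.mul_assoc, ← Matrix.mul_assoc U, hUU', Matrix.one_mul, hSR]
  have htr : ∀ W W' : Matrix (Fin n) (Fin m) ℝ, ∑ j, ∑ a, W j a * W' j a = (Wᵀ * W').trace := by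
    intro W W'
    rw [Finset.sum_comm]
    simp [Matrix.trace, Matrix.mul_apply]
  -- The pairing with `V` is the inner product of `r`, of norm at most 1, with a kernel expansion.
  have hdual : ∀ W : Matrix (Fin n) (Fin m) ℝ,
      (∑ j, ∑ a, W j a * V j a) ^ 2 ≤ (n * ‖M‖) * ∑ j, ∑ a, μ j * W j a ^ 2 := by
    intro W
    refine le_trans ?_ (norm_sum_kerFun_sq_le hk hM hH hU W)
    have h1 : ∑ j, ∑ a, W j a * V j a =
        ⟪r, ∑ j, RKHS.kerFun H (x j) (WithLp.toLp 2 ((U * W).row j))⟫ := by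
      rw [inner_sum_kerFun, htr]
      have := htr (U * W) R
      refine Eq.trans ?_ this.symm
      rw [Matrix.transpose_mul, Matrix.mul_assoc]
    rw [h1, ← sq_abs]
    refine pow_le_pow_left₀ (abs_nonneg _) ((abs_real_inner_le_norm _ _).trans ?_) 2
    exact mul_le_of_le_one_left (norm_nonneg _) hr
  have hmain := sum_sq_le_of_isSatisfiable hU.antitone (eigenvalue_nonneg hk hU) hS hV
    (by positivity) hdual
  refine le_trans (le_of_eq ?_) hmain
  have h1 : ∑ j, ∑ a, V j a ^ 2 = ∑ j, ∑ a, R j a ^ 2 := by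
    simp only [sq]
    rw [htr, htr]
    simp only [V]
    rw [Matrix.transpose_mul, Matrix.transpose_transpose, Matrix.mul_assoc,
      ← Matrix.mul_assoc U, hUU', Matrix.one_mul]
  rw [h1]
  refine Finset.sum_congr rfl fun i _ => ?_
  rw [hΓ', ← norm_neg, neg_sub, EuclideanSpace.norm_sq_eq]
  simp [R, r]

end Sketch

/-! ### Empirical risk of the sketched estimator -/

section EmpiricalRisk

open scoped RealInnerProductSpace

variable {X H : Type*} {m n s : ℕ} [NormedAddCommGroup H] [InnerProductSpace ℝ H] [CompleteSpace H]
  [RKHS ℝ H X (EuclideanSpace ℝ (Fin m))] {k : X → X → ℝ} {M : Matrix (Fin m) (Fin m) ℝ}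

/-- The reproducing property turns the matrix objective into a regularized empirical risk in `H`,
where competitors can be compared. -/
lemma sketchedObjective_eq (hM : M.IsHermitian) (hH : HasDecomposableKernel H k M)
    (ℓ : EuclideanSpace ℝ (Fin m) → EuclideanSpace ℝ (Fin m) → ℝ) (x : Fin n → X)
    (y : Fin n → EuclideanSpace ℝ (Fin m)) (lam : ℝ) (S : Matrix (Fin s) (Fin n) ℝ)
    (Γ : Matrix (Fin s) (Fin m) ℝ) :
    sketchedObjective ℓ (gramMatrix k x) M y lam S Γ =
      (1 / (n : ℝ)) * ∑ i, ℓ (sketchedFunction H x S Γ (x i)) (y i) +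
        lam / 2 * ‖sketchedFunction H x S Γ‖ ^ 2 := by
  have h1 : ∀ i, sketchedFunction H x S Γ (x i) =
      WithLp.toLp 2 ((gramMatrix k x * Sᵀ * Γ * M).row i) := by
    intro i
    rw [sketchedFunction, sum_kerFun_apply hM hH]
    simp only [Matrix.mul_assoc]
  have h2 : ‖sketchedFunction H x S Γ‖ ^ 2 = (S * gramMatrix k x * Sᵀ * Γ * M * Γᵀ).trace := by
    rw [sketchedFunction, norm_sum_kerFun_sq hM hH, Matrix.transpose_mul,
      Matrix.transpose_transpose, ← Matrix.mul_assoc, Matrix.trace_mul_comm]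
    simp only [Matrix.mul_assoc]
  simp only [sketchedObjective, h1, h2]

/-- The empirical risk of the sketched estimator exceeds that of an element of the unit ball by at
most the approximation error of the sketch. -/
lemma sum_loss_sketchedSolution_le (hn : 0 < n) (hk : IsScalarKernel k) (hM : M.IsHermitian)
    (hH : HasDecomposableKernel H k M) {x : Fin n → X} {U : Matrix (Fin n) (Fin n) ℝ}
    {μ : Fin n → ℝ} (hU : IsEigendecomposition ((1 / (n : ℝ)) • gramMatrix k x) U μ)
    {S : Matrix (Fin s) (Fin n) ℝ} {c : ℝ} (hc : 0 ≤ c) (hS : IsSatisfiable U μ S c)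
    {ℓ : EuclideanSpace ℝ (Fin m) → EuclideanSpace ℝ (Fin m) → ℝ} {J : ℝ≥0}
    {y : Fin n → EuclideanSpace ℝ (Fin m)} (hℓ : ∀ i, LipschitzWith J fun z => ℓ z (y i))
    {lam : ℝ} (hlam : 0 ≤ lam) {Γ : Matrix (Fin s) (Fin m) ℝ}
    (hΓ : IsSketchedSolution H k M ℓ lam x y S Γ) (f : H) (hf : ‖f‖ ≤ 1) :
    ∑ i, (ℓ (sketchedFunction H x S Γ (x i)) (y i) - ℓ (f (x i)) (y i)) ≤
      n * (J * (1 + √6 * c) * √(lam + ‖M‖ * criticalRadiusSq μ) + lam / 2) := by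
  have hn' : (0 : ℝ) < n := by exact_mod_cast hn
  obtain ⟨Γ', hΓ'1, hΓ'2⟩ := exists_sketchedFunction_approx hk hM hH hU hS f hf
  have hmin := hΓ.2 Γ' hΓ'1
  rw [sketchedObjective_eq hM hH, sketchedObjective_eq hM hH] at hmin
  set r := criticalRadiusSq μ
  have hr : 0 ≤ r := criticalRadiusSq_nonneg μ
  have h1 : ∑ i, ℓ (sketchedFunction H x S Γ (x i)) (y i) ≤
      ∑ i, ℓ (sketchedFunction H x S Γ' (x i)) (y i) + n * (lam / 2) := by
    have h2 : lam / 2 * ‖sketchedFunction H x S Γ'‖ ^ 2 ≤ lam / 2 :=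
      mul_le_of_le_one_right (by positivity) (pow_le_one₀ (norm_nonneg _) hΓ'1)
    have h3 : 0 ≤ lam / 2 * ‖sketchedFunction H x S Γ‖ ^ 2 := by positivity
    have h4 := mul_le_mul_of_nonneg_left (hmin.trans (add_le_add_right h2 _)) hn'.le
    have h5 : ∀ a : ℝ, n * (1 / n * a) = a := fun a => by
      rw [← mul_assoc, mul_one_div_cancel hn'.ne', one_mul]
    rw [mul_add, mul_add, h5, h5] at h4
    have h6 := mul_nonneg hn'.le h3
    linarith
  have h2 : ∑ i, (ℓ (sketchedFunction H x S Γ' (x i)) (y i) - ℓ (f (x i)) (y i)) ≤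
      J * ∑ i, ‖sketchedFunction H x S Γ' (x i) - f (x i)‖ := by
    rw [Finset.mul_sum]
    refine Finset.sum_le_sum fun i _ => (le_abs_self _).trans ?_
    have := (hℓ i).dist_le_mul (sketchedFunction H x S Γ' (x i)) (f (x i))
    rwa [Real.dist_eq, dist_eq_norm] at this
  have h3 : ∑ i, ‖sketchedFunction H x S Γ' (x i) - f (x i)‖ ≤
      n * ((1 + √6 * c) * √(lam + ‖M‖ * r)) := by
    have hcs : (∑ i, ‖sketchedFunction H x S Γ' (x i) - f (x i)‖) ^ 2 ≤
        n * ∑ i, ‖sketchedFunction H x S Γ' (x i) - f (x i)‖ ^ 2 := by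
      simpa using sq_sum_le_card_mul_sum_sq (s := Finset.univ)
        (f := fun i => ‖sketchedFunction H x S Γ' (x i) - f (x i)‖)
    refine le_of_sq_le_sq (hcs.trans ?_) (by positivity)
    have h6 : √6 ^ 2 = (6 : ℝ) := Real.sq_sqrt (by norm_num)
    have hMr : 0 ≤ ‖M‖ * r := by positivity
    -- The projection argument gives the smaller factor `√(1 + 2c²)`, without `lam` under the root;
    -- both are relaxed to the stated form.
    have h7 : 1 + 2 * c ^ 2 ≤ (1 + √6 * c) ^ 2 := by
      have : 0 ≤ √6 * c := by positivity
      nlinarith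
    calc (n : ℝ) * ∑ i, ‖sketchedFunction H x S Γ' (x i) - f (x i)‖ ^ 2
        ≤ n * ((1 + 2 * c ^ 2) * (n * ‖M‖ * r)) := by gcongr
      _ = n ^ 2 * ((1 + 2 * c ^ 2) * (‖M‖ * r)) := by ring
      _ ≤ n ^ 2 * ((1 + √6 * c) ^ 2 * (lam + ‖M‖ * r)) := by
          gcongr
          linarith
      _ = (n * ((1 + √6 * c) * √(lam + ‖M‖ * r))) ^ 2 := by
          rw [mul_pow, mul_pow, Real.sq_sqrt (by positivity)]
  have h4 := mul_le_mul_of_nonneg_left h3 J.coe_nonneg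
  rw [Finset.sum_sub_distrib] at h2 ⊢
  linarith

end EmpiricalRisk

/-- The exceptional sets need not be measurable, so the event is the complement of a measurable
hull. -/
lemma exists_measurableSet_of_measureReal_le {Ω : Type*} [MeasurableSpace Ω] {Pr : Measure Ω}
    [IsProbabilityMeasure Pr] {E : Set Ω} {δ : ℝ} (hE : Pr.real E ≤ δ) {p : Ω → Prop}
    (hp : ∀ᵐ ω ∂Pr, p ω) :
    ∃ A : Set Ω, MeasurableSet A ∧ 1 - δ ≤ Pr.real A ∧ ∀ ω ∈ A, ω ∉ E ∧ p ω := by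
  set N : Set Ω := E ∪ {ω | ¬ p ω}
  refine ⟨(toMeasurable Pr N)ᶜ, (measurableSet_toMeasurable _ _).compl, ?_, fun ω hω => ?_⟩
  · rw [probReal_compl_eq_one_sub (measurableSet_toMeasurable _ _), measureReal_def,
      measure_toMeasurable, ← measureReal_def]
    have h0 : Pr.real {ω | ¬ p ω} = 0 := by
      rw [measureReal_def, ae_iff.1 hp, ENNReal.toReal_zero]
    have := measureReal_union_le (μ := Pr) E {ω | ¬ p ω}
    linarith
  · have h1 : ω ∉ N := fun h => hω (subset_toMeasurable _ _ h)
    simp only [N, Set.mem_union, not_or] at h1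
    exact ⟨h1.1, not_not.1 h1.2⟩

/-! ### Uniform generalization over a possibly nonseparable unit ball -/

section Generalization

open scoped RealInnerProductSpace

variable {X H : Type*} {m n : ℕ} [NormedAddCommGroup H] [InnerProductSpace ℝ H] [CompleteSpace H]
  [RKHS ℝ H X (EuclideanSpace ℝ (Fin m))] [MeasurableSpace X]

/-- Uniform generalization bound for losses relative to a reference function over the unit ball of
a vector-valued RKHS. -/
lemma exists_event_integral_le {B : ℝ} (hB : 0 ≤ B)
    (hK : ∀ a b, Measurable fun p : X × X => ⟪coordKer H p.1 a, coordKer H p.2 b⟫)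
    (he : ∀ x : X, ∑ a, ‖coordKer H x a‖ ^ 2 ≤ B ^ 2)
    (P : Measure (X × EuclideanSpace ℝ (Fin m))) [IsProbabilityMeasure P]
    {h : H → X × EuclideanSpace ℝ (Fin m) → ℝ} (hm : ∀ f, Measurable (h f))
    (hb : ∀ f, ‖f‖ ≤ 1 → ∀ p, |h f p| ≤ 1) {J : ℝ} (hJ : 0 ≤ J)
    (hlip : ∀ f g p, |h f p - h g p| ≤ J * ‖f p.1 - g p.1‖) (hn : 0 < n)
    {Ω : Type*} [MeasurableSpace Ω] (Pr : Measure Ω) [IsProbabilityMeasure Pr]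
    (Z : Fin n → Ω → X × EuclideanSpace ℝ (Fin m)) (hZ_meas : ∀ i, Measurable (Z i))
    (hZ_law : ∀ i, Pr.map (Z i) = P) (hZ_indep : iIndepFun Z Pr) {δ : ℝ} (hδ : 0 < δ)
    (hδ' : δ ≤ 1) {q : Ω → Prop} (hq : ∀ᵐ ω ∂Pr, q ω) :
    ∃ A : Set Ω, MeasurableSet A ∧ 1 - δ ≤ Pr.real A ∧ ∀ ω ∈ A, q ω ∧ ∀ f : H, ‖f‖ ≤ 1 →
      n * ∫ p, h f p ∂P ≤ ∑ i, h f (Z i ω) + 5 * J * B * √n + √(8 * Real.log (1 / δ) * n) := by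
  set ρ := P.map Prod.fst
  have hρ : IsProbabilityMeasure ρ := Measure.isProbabilityMeasure_map measurable_fst.aemeasurable
  obtain ⟨K, _, hKsep, hKperp, hKmeas⟩ := exists_separable_submodule ρ hK hB he
  obtain ⟨t, ht, htc, htd⟩ :=
    (hKsep.mono fun f (hf : f ∈ (K : Set H) ∩ Metric.closedBall 0 1) =>
      hf.1).exists_countable_dense_subset
  have htb : ∀ f ∈ t, ‖f‖ ≤ 1 := fun f hf => by simpa using (ht hf).2
  have hcount : Countable t := htc.to_subtype
  set r := 4 * J * B * √n + √(8 * Real.log (1 / δ) * n)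
  set E : Set (Fin n → X × EuclideanSpace ℝ (Fin m)) :=
    {z | ∃ f : t, r < ∑ i, (∫ p, h f p ∂P - h f (z i))}
  have hE : (Measure.pi fun _ : Fin n => P).real E ≤ δ :=
    measureReal_exists_empirical_gt_le (h := fun f : t => h f) (f := fun f : t => (f : H))
      (e := fun p a => coordKer H p.1 a) (fun f => hm f) (fun f => hb f (htb f f.2))
      (fun f => htb f f.2) (fun f a => by
        simp only [inner_coordKer]
        have := RKHS.measurable_coe hK (f : H)
        fun_prop) hB (fun p => he p.1) hJ
      (fun f g p => by
        rw [← norm_eval_eq_sqrt, RKHS.coe_sub]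
        exact hlip f g p) hn hδ hδ'
  have hmap : Pr.map (fun ω i => Z i ω) = Measure.pi fun _ : Fin n => P := by
    rw [(iIndepFun_iff_map_fun_eq_pi_map fun i => (hZ_meas i).aemeasurable).1 hZ_indep]
    simp only [hZ_law]
  have hE' : Pr.real ((fun ω i => Z i ω) ⁻¹' E) ≤ δ := by
    refine le_trans ?_ hE
    rw [← hmap]
    exact ENNReal.toReal_mono (measure_ne_top _ _)
      (Measure.le_map_apply (measurable_pi_iff.2 hZ_meas).aemeasurable E)
  -- This condition involves only kernel functions at the sample points, so one null set serves
  -- every `f` in the ball.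
  have hpair : ∀ᵐ ω ∂Pr, ∀ i j, i ≠ j → ∀ a b,
      ⟪K.starProjection (coordKer H (Z i ω).1 a), coordKer H (Z j ω).1 b⟫ =
        ⟪coordKer H (Z i ω).1 a, coordKer H (Z j ω).1 b⟫ := by
    simp only [ae_all_iff]
    intro i j hij a b
    have hprod : ∀ᵐ p ∂(ρ.prod ρ),
        ⟪K.starProjection (coordKer H p.1 a), coordKer H p.2 b⟫ =
          ⟪coordKer H p.1 a, coordKer H p.2 b⟫ := by
      -- For fixed `x` the component off `K` vanishes almost everywhere in `x'`; Fubini and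
      -- independence carry this to pairs of distinct sample points.
      rw [Measure.ae_prod_iff_ae_ae (measurableSet_eq_fun (hKmeas a b) (hK a b))]
      refine .of_forall fun x => ?_
      filter_upwards [hKperp _ (K.sub_starProjection_mem_orthogonal (coordKer H x a))] with x' hx'
      have h0 : ⟪coordKer H x a - K.starProjection (coordKer H x a), coordKer H x' b⟫ = 0 := by
        rw [inner_coordKer, hx']
        rfl
      rw [inner_sub_left] at h0
      linarith
    have hi : ∀ i, Measurable fun ω => (Z i ω).1 := fun i => measurable_fst.comp (hZ_meas i)
    have hlaw : ∀ i, Pr.map (fun ω => (Z i ω).1) = ρ := by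
      intro i
      simp only [ρ]
      rw [← hZ_law i, Measure.map_map measurable_fst (hZ_meas i)]
      rfl
    have hind : IndepFun (fun ω => (Z i ω).1) (fun ω => (Z j ω).1) Pr :=
      (hZ_indep.indepFun hij).comp measurable_fst measurable_fst
    rw [indepFun_iff_map_prod_eq_prod_map_map (hi i).aemeasurable (hi j).aemeasurable, hlaw,
      hlaw] at hind
    rw [← hind] at hprod
    exact ae_of_ae_map ((hi i).prodMk (hi j)).aemeasurable hprod
  obtain ⟨A, hA, hAδ, hAω⟩ := exists_measurableSet_of_measureReal_le hE' (hq.and hpair)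
  refine ⟨A, hA, hAδ, fun ω hω => ⟨(hAω ω hω).2.1, fun f hf => ?_⟩⟩
  obtain ⟨hωE, -, hωK⟩ := hAω ω hω
  have hint : ∀ f, ‖f‖ ≤ 1 → Integrable (h f) P := fun f hf => integrable_of_abs_le (hm f) (hb f hf)
  have hlip' : ∀ f g p, |h f p - h g p| ≤ J * (B * ‖f - g‖) := fun f g p =>
    (hlip f g p).trans (mul_le_mul_of_nonneg_left (by
      have := norm_eval_le hB (he p.1) (f - g)
      rwa [RKHS.coe_sub] at this) hJ)
  have hdense : ∀ g ∈ K, ‖g‖ ≤ 1 → ∑ i, (∫ p, h g p ∂P - h g (Z i ω)) ≤ r := by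
    intro g hgK hg
    refine le_of_forall_pos_le_add fun ε hε => ?_
    -- Moving from `g` to `d` changes each mean and each sample value by at most `J B ‖g - d‖`.
    -- Dividing by `C + 1` covers `C = 0`.
    set C := n * (2 * (J * B))
    have hC : 0 ≤ C := by positivity
    obtain ⟨d, hd, hgd⟩ := Metric.mem_closure_iff.1
      (htd ⟨hgK, by simpa using hg⟩ : g ∈ closure t) (ε / (C + 1)) (by positivity)
    have hd' : ∑ i, (∫ p, h d p ∂P - h d (Z i ω)) ≤ r := by
      by_contra hcon
      exact hωE ⟨⟨d, hd⟩, not_le.1 hcon⟩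
    have hdiff : ∀ i, (∫ p, h g p ∂P - h g (Z i ω)) - (∫ p, h d p ∂P - h d (Z i ω)) ≤
        2 * (J * (B * ‖g - d‖)) := by
      intro i
      have h1 : |∫ p, h g p ∂P - ∫ p, h d p ∂P| ≤ J * (B * ‖g - d‖) := by
        rw [← integral_sub (hint g hg) (hint d (htb d hd))]
        exact abs_integral_le_of_abs_le fun p => hlip' g d p
      have h2 := (abs_le.1 h1).2
      have h3 := (abs_le.1 (hlip' g d (Z i ω))).1
      linarith
    have hsum := Finset.sum_le_sum fun i (_ : i ∈ Finset.univ) => hdiff i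
    rw [Finset.sum_sub_distrib] at hsum
    simp only [Finset.sum_const, Finset.card_univ, Fintype.card_fin, nsmul_eq_mul] at hsum
    have h4 : C * ‖g - d‖ ≤ ε := by
      rw [dist_eq_norm, lt_div_iff₀ (by positivity)] at hgd
      nlinarith [norm_nonneg (g - d)]
    have h5 : (n : ℝ) * (2 * (J * (B * ‖g - d‖))) = C * ‖g - d‖ := by simp only [C]; ring
    linarith
  have hf₀ : ‖K.starProjection f‖ ≤ 1 := (K.norm_starProjection_apply_le f).trans hf
  have h1 := hdense _ (K.starProjection_apply_mem f) hf₀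
  have h2 : ∫ p, h (K.starProjection f) p ∂P = ∫ p, h f p ∂P := by
    refine integral_congr_ae ?_
    have hae : ∀ᵐ p ∂P, (f - K.starProjection f) p.1 = 0 :=
      ae_of_ae_map measurable_fst.aemeasurable
        (hKperp _ (K.sub_starProjection_mem_orthogonal f))
    filter_upwards [hae] with p hp
    have h3 := hlip f (K.starProjection f) p
    rw [RKHS.coe_sub, Pi.sub_apply] at hp
    rw [hp, norm_zero, mul_zero] at h3
    have := abs_nonpos_iff.1 h3
    linarith
  -- The part of `f` off `K` does not affect the mean, but it can be nonzero at the sample points;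
  -- it adds the fifth `J B √n`.
  have h3 := sum_norm_eval_sub_starProjection_le hB he K (fun i => (Z i ω).1) hωK f hf
  have h4 : ∑ i, (h (K.starProjection f) (Z i ω) - h f (Z i ω)) ≤
      J * ∑ i, ‖(f - K.starProjection f) (Z i ω).1‖ := by
    rw [Finset.mul_sum]
    refine Finset.sum_le_sum fun i _ => ?_
    rw [RKHS.coe_sub]
    have := (abs_le.1 (hlip f (K.starProjection f) (Z i ω))).1
    rw [Pi.sub_apply]
    linarith
  have h5 := mul_le_mul_of_nonneg_left h3 hJ
  rw [Finset.sum_sub_distrib] at h1 h4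
  simp only [Finset.sum_const, Finset.card_univ, Fintype.card_fin, nsmul_eq_mul] at h1
  rw [h2] at h1
  simp only [r] at h1
  linarith

end Generalization

/-! ### Assembly of the excess risk bound -/

theorem mainTheorem3
    {X : Type*} [MeasurableSpace X] {m n s : ℕ} (hn : 0 < n)
    -- the vector-valued RKHS of the decomposable kernel `k M`
    (H : Type*) [NormedAddCommGroup H] [InnerProductSpace ℝ H] [CompleteSpace H]
    [RKHS ℝ H X (EuclideanSpace ℝ (Fin m))]
    (k : X → X → ℝ) (hk : IsScalarKernel k) (hk_meas : Measurable (Function.uncurry k))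
    (M : Matrix (Fin m) (Fin m) ℝ) (hM : M.PosSemidef) (hM_inv : IsUnit M)
    (hH : HasDecomposableKernel H k M)
    (κ : ℝ) (hκ : ∀ x x', k x x' ≤ κ)
    -- the law of `(X, Y)`, with `Y` in the output set `𝒴`
    (P : Measure (X × EuclideanSpace ℝ (Fin m))) [IsProbabilityMeasure P]
    (𝒴 : Set (EuclideanSpace ℝ (Fin m))) (h𝒴 : ∀ᵐ p ∂P, p.2 ∈ 𝒴)
    -- the loss
    (ℓ : EuclideanSpace ℝ (Fin m) → EuclideanSpace ℝ (Fin m) → ℝ)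
    (hℓ_meas : Measurable (Function.uncurry ℓ))
    (J : ℝ≥0) (hℓ_lip : ∀ y ∈ 𝒴, LipschitzWith J (fun z => ℓ z y))
    (hℓ_unit : ∀ f g : H, ‖f‖ ≤ 1 → ‖g‖ ≤ 1 → ∀ x, ∀ y ∈ 𝒴, |ℓ (f x) y - ℓ (g x) y| ≤ 1)
    -- attainability in the unit ball
    (fH : H) (hfH_ball : ‖fH‖ ≤ 1) (hfH_int : Integrable (fun p => ℓ (fH p.1) p.2) P)
    (hfH_min : ∀ f : H, ‖f‖ ≤ 1 → risk P ℓ fH ≤ risk P ℓ f)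
    -- the i.i.d. sample
    {Ω : Type*} [MeasurableSpace Ω] (Pr : Measure Ω) [IsProbabilityMeasure Pr]
    (Z : Fin n → Ω → X × EuclideanSpace ℝ (Fin m)) (hZ_meas : ∀ i, Measurable (Z i))
    (hZ_law : ∀ i, Pr.map (Z i) = P) (hZ_indep : iIndepFun Z Pr)
    -- eigendecomposition of the normalized Gram matrix
    (U : Ω → Matrix (Fin n) (Fin n) ℝ) (μ : Ω → Fin n → ℝ)
    (hU : ∀ ω, IsEigendecomposition ((1 / (n : ℝ)) • gramMatrix k (fun i => (Z i ω).1))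
      (U ω) (μ ω))
    -- the sketch and the sketched estimator
    (c : ℝ) (hc : 0 < c) (S : Ω → Matrix (Fin s) (Fin n) ℝ)
    (hS : ∀ᵐ ω ∂Pr, IsSatisfiable (U ω) (μ ω) (S ω) c)
    (lam : ℝ) (hlam : 0 ≤ lam) (Γ : Ω → Matrix (Fin s) (Fin m) ℝ)
    (hΓ : ∀ᵐ ω ∂Pr, IsSketchedSolution H k M ℓ lam (fun i => (Z i ω).1) (fun i => (Z i ω).2)
      (S ω) (Γ ω))
    (δ : ℝ) (hδ : δ ∈ Set.Ioo (0 : ℝ) 1) :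
    ∃ A : Set Ω, MeasurableSet A ∧ 1 - δ ≤ Pr.real A ∧ ∀ ω ∈ A,
      risk P ℓ (sketchedFunction H (fun i => (Z i ω).1) (S ω) (Γ ω)) ≤
        risk P ℓ fH + J * (1 + √6 * c) * √(lam + ‖M‖ * criticalRadiusSq (μ ω)) + lam / 2 +
          8 * J * √(κ * M.trace / n) + 2 * √(8 * Real.log (4 / δ) / n) := by
  have hherm := hM.1
  obtain ⟨p₀⟩ := nonempty_of_isProbabilityMeasure P
  have hκ0 : 0 ≤ κ := by
    have := hk.nonneg 1 (fun _ => p₀.1) fun _ => 1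
    simp only [Finset.univ_unique, Finset.sum_singleton, one_mul, mul_one] at this
    exact this.trans (hκ _ _)
  have htr : 0 ≤ M.trace := hM.trace_nonneg
  set B := √(κ * M.trace)
  have hB2 : B ^ 2 = κ * M.trace := Real.sq_sqrt (by positivity)
  have he : ∀ x : X, ∑ a, ‖coordKer H x a‖ ^ 2 ≤ B ^ 2 := by
    intro x
    simp only [← real_inner_self_eq_norm_sq, inner_coordKer_coordKer hH]
    rw [← Finset.mul_sum, hB2]
    exact mul_le_mul_of_nonneg_right (hκ x x) htr
  have hK : ∀ a b, Measurable fun p : X × X => inner ℝ (coordKer H p.1 a) (coordKer H p.2 b) := by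
    intro a b
    simp only [inner_coordKer_coordKer hH]
    exact hk_meas.mul_const _
  -- `𝒴` need not be measurable. Restricting to a measurable set of full measure makes the bound and
  -- the Lipschitz estimate for `h` hold at every point.
  obtain ⟨G, hGae, hGm, hG⟩ := h𝒴.exists_measurable_mem
  set h : H → X × EuclideanSpace ℝ (Fin m) → ℝ := fun f =>
    G.indicator fun p => ℓ (f p.1) p.2 - ℓ (fH p.1) p.2
  have hℓf : ∀ f : H, Measurable fun p : X × EuclideanSpace ℝ (Fin m) => ℓ (f p.1) p.2 := fun f =>
    hℓ_meas.comp (((RKHS.measurable_coe hK f).comp measurable_fst).prodMk measurable_snd)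
  have hm : ∀ f, Measurable (h f) := fun f => ((hℓf f).sub (hℓf fH)).indicator hGm
  have hb : ∀ f, ‖f‖ ≤ 1 → ∀ p, |h f p| ≤ 1 := by
    intro f hf p
    by_cases hp : p ∈ G
    · simp only [h, Set.indicator_of_mem hp]
      exact hℓ_unit f fH hf hfH_ball _ _ (hG p hp)
    · simp [h, Set.indicator_of_notMem hp]
  have hlip : ∀ f g p, |h f p - h g p| ≤ J * ‖f p.1 - g p.1‖ := by
    intro f g p
    by_cases hp : p ∈ G
    · simp only [h, Set.indicator_of_mem hp, sub_sub_sub_cancel_right]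
      have := (hℓ_lip _ (hG p hp)).dist_le_mul (f p.1) (g p.1)
      rwa [Real.dist_eq, dist_eq_norm] at this
    · simp only [h, Set.indicator_of_notMem hp, sub_zero, abs_zero]
      positivity
  have hZG : ∀ᵐ ω ∂Pr, ∀ i, Z i ω ∈ G := by
    rw [ae_all_iff]
    intro i
    refine ae_of_ae_map (hZ_meas i).aemeasurable (p := fun p => p ∈ G) ?_
    rw [hZ_law]
    exact hGae
  obtain ⟨A, hA, hAδ, hAω⟩ := exists_event_integral_le (Real.sqrt_nonneg _) hK he P hm hb
    J.coe_nonneg hlip hn Pr Z hZ_meas hZ_law hZ_indep hδ.1 hδ.2.le (hZG.and (hS.and hΓ))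
  refine ⟨A, hA, hAδ, fun ω hω => ?_⟩
  obtain ⟨⟨hωG, hωS, hωΓ⟩, hωf⟩ := hAω ω hω
  set f := sketchedFunction H (fun i => (Z i ω).1) (S ω) (Γ ω)
  have h1 := hωf f hωΓ.1
  have h2 : ∑ i, h f (Z i ω) = ∑ i, (ℓ (f (Z i ω).1) (Z i ω).2 - ℓ (fH (Z i ω).1) (Z i ω).2) :=
    Finset.sum_congr rfl fun i _ => Set.indicator_of_mem (hωG i) _
  have h3 := sum_loss_sketchedSolution_le hn hk hherm hH (hU ω) hc.le hωS
    (fun i => hℓ_lip _ (hG _ (hωG i))) hlam hωΓ fH hfH_ball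
  have hdiff : (fun p => ℓ (f p.1) p.2) =ᵐ[P] fun p => h f p + ℓ (fH p.1) p.2 := by
    filter_upwards [hGae] with p hp
    simp [h, Set.indicator_of_mem hp]
  have h4 : risk P ℓ f = ∫ p, h f p ∂P + risk P ℓ fH := by
    rw [risk, integral_congr_ae hdiff,
      integral_add (integrable_of_abs_le (hm f) (hb f hωΓ.1)) hfH_int]
    rfl
  have hn' : (0 : ℝ) < n := by exact_mod_cast hn
  have hδ0 := hδ.1
  have hsqrt : ∀ a : ℝ, √(a * n) = n * √(a / n) := by
    intro a
    rw [show a * n = (n : ℝ) ^ 2 * (a / n) by field_simp, Real.sqrt_mul (by positivity),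
      Real.sqrt_sq hn'.le]
  have h5 : B * √n = n * √(κ * M.trace / n) := by
    rw [← hsqrt, Real.sqrt_mul (by positivity)]
  -- The deviation argument gives constants 5 and 1 with `log (1 / δ)`; the stated 8, 2 and `log (4
  -- / δ)` are larger.
  have h6 : √(8 * Real.log (1 / δ) / n) ≤ √(8 * Real.log (4 / δ) / n) := by
    gcongr
    norm_num
  have h7 : (0 : ℝ) ≤ J * √(κ * M.trace / n) := by positivity
  have h8 : 0 ≤ √(8 * Real.log (4 / δ) / n) := Real.sqrt_nonneg _
  rw [h2, hsqrt, mul_assoc (5 * (J : ℝ)), h5] at h1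
  have h9 : (n : ℝ) * ∫ p, h f p ∂P ≤
      n * (J * (1 + √6 * c) * √(lam + ‖M‖ * criticalRadiusSq (μ ω)) + lam / 2 +
        5 * J * √(κ * M.trace / n) + √(8 * Real.log (1 / δ) / n)) := by
    linarith
  have h10 := le_of_mul_le_mul_left h9 hn'
  rw [h4]
  linarith
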